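/- Let $\mathbb{QU}$ be the rational Urysohn metric space, i.e. the (up to isometry unique) countable metric space with only rational distances such that, for every finite metric space $Y$ with rational distances and every $y\in Y$, each isometric embedding $Y\setminus\{y\}\to\mathbb{QU}$ extends to an isometric embedding $Y\to\mathbb{QU}$. Equip its group $G=\mathrm{Isom}(\mathbb{QU})$ of surjective isometries with the permutation group topology, whose basic open sets are $\{g\in G : g(x)=f(x)\text{ for all }x\in A\}$ for $f\in G$ and finite $A\subseteq\mathbb{QU}$. For a group $\Gamma$, let $\mathrm{Isom}(\Gamma,\mathbb{QU})$ be the set of homomorphisms $\pi\colon\Gamma\to G$ with the subspace topology from $G^\Gamma$, on which $G$ acts by $(a\cdot\pi)(\gamma)=a\,\pi(\gamma)\,a^{-1}$. Call $\pi$ *generic* if its orbit $G\cdot\pi$ is comeagre in $\mathrm{Isom}(\Gamma,\mathbb{QU})$. The group $\Gamma$ has *property (RZ)* if every product $H_1H_2\cdots H_n$ of finitely many finitely generated subgroups of $\Gamma$ is closed in the profinite topology on $\Gamma$, i.e. the topology generated by the cosets of the normal subgroups of finite index. Let $\Gamma$ be a finitely generated group with property (RZ) and let $\Lambda\leqslant\Gamma$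 be a finitely generated subgroup. Then for every generic $\pi\in\mathrm{Isom}(\Gamma,\mathbb{QU})$, the restriction $\pi|_\Lambda\in\mathrm{Isom}(\Lambda,\mathbb{QU})$ is generic. Conversely, for every generic $\sigma\in\mathrm{Isom}(\Lambda,\mathbb{QU})$ there is a generic $\pi\in\mathrm{Isom}(\Gamma,\mathbb{QU})$ with $\pi|_\Lambda=\sigma$. -/

import Mathlib

open scoped Pointwise

/-! ### The rational Urysohn metric space

A metric is built on `ℕ` by adding one point at a time: the `n`-th point realises over the points
`0, …, n - 1` the one-point metric extension prescribed by the `n`-th entry of an enumeration of all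
finite prescriptions of rational distances (each prescription being listed infinitely often). -/

/-- A nonempty finite list of prescriptions "the new point has distance `q` from the point `i`",
given as pairs `(i, q)`. -/
abbrev ExtTask : Type := {s : Finset (ℕ × ℚ) // s.Nonempty}

/-- The task `{(0, 1)}`. -/
def ExtTask.default : ExtTask := ⟨{(0, 1)}, Finset.singleton_nonempty _⟩

/-- An enumeration of all tasks, each occurring infinitely often. -/
noncomputable def taskSeq (n : ℕ) : ExtTask :=
  (Encodable.decode n.unpair.2).getD ExtTask.default

/-- A task can be carried out over the points `0, …, n - 1` with distance function `D` if it only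
prescribes positive distances to these points and respects the triangle inequality. -/
def ExtTask.Admissible (s : ExtTask) (n : ℕ) (D : ℕ → ℕ → ℚ) : Prop :=
  ∀ p ∈ s.1, p.1 < n ∧ 0 < p.2 ∧ ∀ q ∈ s.1, D p.1 q.1 ≤ p.2 + q.2

/-- Distance from the new point to the point `j`: the shortest path through prescribed points. -/
def ExtTask.newDist (s : ExtTask) (D : ℕ → ℕ → ℚ) (j : ℕ) : ℚ :=
  s.1.inf' s.2 fun p => p.2 + D p.1 j

open Classical in
/-- The task carried out at stage `n`. -/
noncomputable def stageTask (n : ℕ) (D : ℕ → ℕ → ℚ) : ExtTask :=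
  if (taskSeq n).Admissible n D then taskSeq n else ExtTask.default

/-- Adding the point `n` to the points `0, …, n - 1` with distance function `D`. -/
noncomputable def extendDist (n : ℕ) (D : ℕ → ℕ → ℚ) (i j : ℕ) : ℚ :=
  if i = j then 0
  else if i = n then (stageTask n D).newDist D j
  else if j = n then (stageTask n D).newDist D i
  else D i j

/-- The distance function after stage `n`; it is relevant on the points `0, …, n - 1` only. -/
noncomputable def stageDist : ℕ → ℕ → ℕ → ℚ
  | 0 => fun _ _ => 0
  | n + 1 => extendDist n (stageDist n)

theorem ExtTask.newDist_le (s : ExtTask) (D : ℕ → ℕ → ℚ) (j : ℕ) {p : ℕ × ℚ} (hp : p ∈ s.1) :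
    s.newDist D j ≤ p.2 + D p.1 j :=
  Finset.inf'_le (fun p : ℕ × ℚ => p.2 + D p.1 j) hp

theorem ExtTask.exists_newDist_eq (s : ExtTask) (D : ℕ → ℕ → ℚ) (j : ℕ) :
    ∃ p ∈ s.1, s.newDist D j = p.2 + D p.1 j :=
  Finset.exists_mem_eq_inf' s.2 fun p : ℕ × ℚ => p.2 + D p.1 j

theorem stageDist_self (n i : ℕ) : stageDist n i i = 0 := by
  cases n <;> simp [stageDist, extendDist]

theorem stageDist_comm (n i j : ℕ) : stageDist n i j = stageDist n j i := by
  induction n with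
  | zero => rfl
  | succ n ih =>
    simp only [stageDist, extendDist]
    split_ifs <;> first | rfl | exact ih | (subst_vars; simp_all)

/-- `D` is a metric on the points `0, …, n - 1`. -/
structure IsMetricBelow (n : ℕ) (D : ℕ → ℕ → ℚ) : Prop where
  pos : ∀ i j, i < n → j < n → i ≠ j → 0 < D i j
  triangle : ∀ i j k, i < n → j < n → k < n → D i k ≤ D i j + D j k

theorem IsMetricBelow.nonneg {n : ℕ} (h : IsMetricBelow n (stageDist n)) {i j : ℕ}
    (hi : i < n) (hj : j < n) : 0 ≤ stageDist n i j := by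
  by_cases hij : i = j
  · subst hij; rw [stageDist_self]
  · exact (h.pos i j hi hj hij).le

theorem stageTask_admissible {n : ℕ} (hn : 0 < n) :
    (stageTask n (stageDist n)).Admissible n (stageDist n) := by
  unfold stageTask
  split_ifs with h
  · exact h
  · intro p hp
    have hp' : p = (0, 1) := by simpa [ExtTask.default] using hp
    subst hp'
    refine ⟨hn, one_pos, fun q hq => ?_⟩
    have hq' : q = (0, 1) := by simpa [ExtTask.default] using hq
    subst hq'
    rw [stageDist_self]
    norm_num

theorem isMetricBelow_stageDist (n : ℕ) : IsMetricBelow n (stageDist n) := by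
  induction n with
  | zero => exact ⟨fun i j hi => absurd hi (Nat.not_lt_zero i),
      fun i j k hi => absurd hi (Nat.not_lt_zero i)⟩
  | succ n ih =>
    set r : ℕ → ℚ := (stageTask n (stageDist n)).newDist (stageDist n) with hr
    have hnew : ∀ j, j < n → stageDist (n + 1) n j = r j := fun j hj => by
      simp [stageDist, extendDist, hj.ne', hr]
    have hnew' : ∀ j, j < n → stageDist (n + 1) j n = r j := fun j hj => by
      rw [stageDist_comm, hnew j hj]
    have hold : ∀ i j, i < n → j < n → stageDist (n + 1) i j = stageDist n i j :=
      fun i j hi hj => by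
        by_cases hij : i = j
        · subst hij; rw [stageDist_self, stageDist_self]
        · simp [stageDist, extendDist, hij, hi.ne, hj.ne]
    have hpos : ∀ j, j < n → 0 < r j := fun j hj => by
      obtain ⟨p, hp, hpj⟩ := (stageTask n (stageDist n)).exists_newDist_eq (stageDist n) j
      have hadm := stageTask_admissible (Nat.zero_lt_of_lt hj) p hp
      have := ih.nonneg hadm.1 hj
      rw [hr, hpj]
      linarith [hadm.2.1]
    have htri1 : ∀ j k, j < n → k < n → r k ≤ r j + stageDist n j k := fun j k hj hk => by
      obtain ⟨p, hp, hpj⟩ := (stageTask n (stageDist n)).exists_newDist_eq (stageDist n) j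
      have hadm := stageTask_admissible (Nat.zero_lt_of_lt hj) p hp
      have h1 := (stageTask n (stageDist n)).newDist_le (stageDist n) k hp
      have h2 := ih.triangle p.1 j k hadm.1 hj hk
      rw [hr, hpj]
      linarith
    have htri2 : ∀ j k, j < n → k < n → stageDist n j k ≤ r j + r k := fun j k hj hk => by
      obtain ⟨p, hp, hpj⟩ := (stageTask n (stageDist n)).exists_newDist_eq (stageDist n) j
      obtain ⟨q, hq, hqk⟩ := (stageTask n (stageDist n)).exists_newDist_eq (stageDist n) k
      have hadm := stageTask_admissible (Nat.zero_lt_of_lt hj) p hp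
      have hadm' := stageTask_admissible (Nat.zero_lt_of_lt hj) q hq
      have h1 := hadm.2.2 q hq
      have h2 := ih.triangle j p.1 k hj hadm.1 hk
      have h3 := ih.triangle p.1 q.1 k hadm.1 hadm'.1 hk
      rw [hr, hpj, hqk]
      rw [stageDist_comm n j p.1] at h2
      linarith
    refine ⟨fun i j hi hj hij => ?_, fun i j k hi hj hk => ?_⟩
    · rcases Nat.lt_succ_iff_lt_or_eq.1 hi with hi | rfl
      · rcases Nat.lt_succ_iff_lt_or_eq.1 hj with hj | rfl
        · rw [hold i j hi hj]; exact ih.pos i j hi hj hij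
        · rw [hnew' i hi]; exact hpos i hi
      · rcases Nat.lt_succ_iff_lt_or_eq.1 hj with hj | rfl
        · rw [hnew j hj]; exact hpos j hj
        · exact absurd rfl hij
    · rcases Nat.lt_succ_iff_lt_or_eq.1 hi with hi | hi <;>
      rcases Nat.lt_succ_iff_lt_or_eq.1 hj with hj | hj <;>
      rcases Nat.lt_succ_iff_lt_or_eq.1 hk with hk | hk
      · rw [hold i k hi hk, hold i j hi hj, hold j k hj hk]
        exact ih.triangle i j k hi hj hk
      · subst hk
        rw [hnew' i hi, hold i j hi hj, hnew' j hj, stageDist_comm]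
        linarith [htri1 j i hj hi]
      · subst hj
        rw [hold i k hi hk, hnew' i hi, hnew k hk]
        exact htri2 i k hi hk
      · subst hj; subst hk
        rw [stageDist_self, add_zero]
      · subst hi
        rw [hnew k hk, hnew j hj, hold j k hj hk]
        exact htri1 j k hj hk
      · subst hi; subst hk
        rw [stageDist_self, hnew j hj, hnew' j hj]
        linarith [hpos j hj]
      · subst hi; subst hj
        rw [stageDist_self, zero_add]
      · subst hi; subst hj; subst hk
        rw [stageDist_self, zero_add]

theorem stageDist_stable {m n i j : ℕ} (hi : i < m) (hj : j < m) (hmn : m ≤ n) :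
    stageDist n i j = stageDist m i j := by
  induction n, hmn using Nat.le_induction with
  | base => rfl
  | succ n hmn ih =>
    rw [← ih]
    by_cases hij : i = j
    · subst hij; rw [stageDist_self, stageDist_self]
    · simp [stageDist, extendDist, hij, (hi.trans_le hmn).ne, (hj.trans_le hmn).ne]

/-- The rational Urysohn metric space, on the underlying set `ℕ`. -/
structure QU : Type where
  /-- The position of a point in the construction. -/
  idx : ℕ

/-- The rational-valued distance of the rational Urysohn space. -/
noncomputable def QU.ratDist (x y : QU) : ℚ :=
  stageDist (max x.idx y.idx + 1) x.idx y.idx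

theorem QU.ratDist_eq (x y : QU) {n : ℕ} (hx : x.idx < n) (hy : y.idx < n) :
    x.ratDist y = stageDist n x.idx y.idx :=
  (stageDist_stable (Nat.lt_succ_of_le (le_max_left _ _)) (Nat.lt_succ_of_le (le_max_right _ _))
    (Nat.succ_le_of_lt (max_lt hx hy))).symm

noncomputable instance QU.instMetricSpace : MetricSpace QU where
  dist x y := (x.ratDist y : ℝ)
  dist_self x := by
    rw [QU.ratDist, stageDist_self, Rat.cast_zero]
  dist_comm x y := by
    rw [QU.ratDist, QU.ratDist, stageDist_comm, max_comm]
  dist_triangle x y z := by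
    have hx : x.idx < x.idx + y.idx + z.idx + 1 := by omega
    have hy : y.idx < x.idx + y.idx + z.idx + 1 := by omega
    have hz : z.idx < x.idx + y.idx + z.idx + 1 := by omega
    rw [QU.ratDist_eq x z hx hz, QU.ratDist_eq x y hx hy, QU.ratDist_eq y z hy hz]
    exact_mod_cast (isMetricBelow_stageDist _).triangle _ _ _ hx hy hz
  eq_of_dist_eq_zero := by
    intro x y h
    change ((x.ratDist y : ℚ) : ℝ) = 0 at h
    by_contra hxy
    have hidx : x.idx ≠ y.idx := fun h' => hxy (by cases x; cases y; cases h'; rfl)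
    have hx : x.idx < x.idx + y.idx + 1 := by omega
    have hy : y.idx < x.idx + y.idx + 1 := by omega
    rw [QU.ratDist_eq x y hx hy] at h
    have := (isMetricBelow_stageDist _).pos _ _ hx hy hidx
    exact this.ne' (by exact_mod_cast h)

theorem QU.dist_eq (x y : QU) : dist x y = (x.ratDist y : ℝ) := rfl

/-- A metric space whose metric takes only rational values. -/
def IsRationalMetric (X : Type*) [MetricSpace X] : Prop :=
  ∀ x y : X, ∃ q : ℚ, dist x y = (q : ℝ)

/-- The properties characterising the rational Urysohn space up to isometry: it is countable, has
only rational distances, and for every finite rational metric space `Y` and `y ∈ Y`, every isometric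
embedding of `Y ∖ {y}` extends to an isometric embedding of `Y`. -/
structure IsRationalUrysohn (U : Type*) [MetricSpace U] : Prop where
  countable : Countable U
  rational : IsRationalMetric U
  extension : ∀ (Y : Type) [MetricSpace Y] [Finite Y], IsRationalMetric Y →
    ∀ (y : Y) (φ : {x : Y // x ≠ y} → U), Isometry φ →
      ∃ ψ : Y → U, Isometry ψ ∧ ∀ x : {x : Y // x ≠ y}, ψ x = φ x

theorem QU.exists_point_of_task (s : ExtTask)
    (hpos : ∀ p ∈ s.1, 0 < p.2)
    (hle : ∀ p ∈ s.1, ∀ q ∈ s.1, (⟨p.1⟩ : QU).ratDist ⟨q.1⟩ ≤ p.2 + q.2)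
    (hge : ∀ p ∈ s.1, ∀ q ∈ s.1, p.2 ≤ q.2 + (⟨q.1⟩ : QU).ratDist ⟨p.1⟩) :
    ∃ z : QU, ∀ p ∈ s.1, z.ratDist ⟨p.1⟩ = p.2 := by
  obtain ⟨M, hM⟩ : ∃ M : ℕ, ∀ p ∈ s.1, p.1 < M :=
    ⟨s.1.sup (fun p => p.1) + 1, fun p hp =>
      Nat.lt_succ_of_le (Finset.le_sup (f := fun p : ℕ × ℚ => p.1) hp)⟩
  set n := Nat.pair M (Encodable.encode s) with hn
  have hMn : M ≤ n := Nat.left_le_pair _ _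
  have hlt : ∀ p ∈ s.1, p.1 < n := fun p hp => (hM p hp).trans_le hMn
  have htask : taskSeq n = s := by
    simp [taskSeq, hn, Nat.unpair_pair, Encodable.encodek]
  have hadm : s.Admissible n (stageDist n) := fun p hp =>
    ⟨hlt p hp, hpos p hp, fun q hq => by
      rw [← QU.ratDist_eq ⟨p.1⟩ ⟨q.1⟩ (hlt p hp) (hlt q hq)]
      exact hle p hp q hq⟩
  have hstage : stageTask n (stageDist n) = s := by
    unfold stageTask
    rw [htask, if_pos hadm]
  refine ⟨⟨n⟩, fun p hp => ?_⟩
  have hpn := hlt p hp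
  rw [QU.ratDist_eq ⟨n⟩ ⟨p.1⟩ (Nat.lt_succ_self n) (hpn.trans (Nat.lt_succ_self n))]
  have : stageDist (n + 1) n p.1 = s.newDist (stageDist n) p.1 := by
    simp [stageDist, extendDist, hpn.ne', hstage]
  rw [this]
  apply le_antisymm
  · have := s.newDist_le (stageDist n) p.1 hp
    rwa [stageDist_self, add_zero] at this
  · obtain ⟨q, hq, hqp⟩ := s.exists_newDist_eq (stageDist n) p.1
    rw [hqp, ← QU.ratDist_eq ⟨q.1⟩ ⟨p.1⟩ (hlt q hq) hpn]
    exact hge p hp q hq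

theorem QU.isRationalUrysohn : IsRationalUrysohn QU where
  countable := Function.Injective.countable (f := QU.idx) fun x y h => by
    cases x; cases y; cases h; rfl
  rational x y := ⟨x.ratDist y, rfl⟩
  extension := by
    classical
    intro Y _ _ hY y φ hφ
    have hfin : Fintype {x : Y // x ≠ y} := Fintype.ofFinite _
    suffices h : ∃ z : QU, ∀ x : {x : Y // x ≠ y}, dist z (φ x) = dist y x by
      obtain ⟨z, hz⟩ := h
      refine ⟨fun x => if h : x = y then z else φ ⟨x, h⟩, Isometry.of_dist_eq fun a b => ?_,
        fun x => by simp [x.2]⟩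
      by_cases ha : a = y <;> by_cases hb : b = y
      · simp [ha, hb]
      · simp only [ha, hb, dif_pos, dif_neg, not_false_eq_true]
        exact hz ⟨b, hb⟩
      · simp only [ha, hb, dif_pos, dif_neg, not_false_eq_true]
        rw [dist_comm, dist_comm a y]
        exact hz ⟨a, ha⟩
      · simp only [ha, hb, dif_neg, not_false_eq_true]
        exact hφ.dist_eq ⟨a, ha⟩ ⟨b, hb⟩
    rcases isEmpty_or_nonempty {x : Y // x ≠ y} with hem | hne
    · exact ⟨⟨0⟩, fun x => hem.elim x⟩
    choose r hr using fun x : {x : Y // x ≠ y} => hY y x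
    have hφd : ∀ a b, (((φ a).ratDist (φ b) : ℚ) : ℝ) = dist (a : Y) b := fun a b =>
      hφ.dist_eq a b
    let s : ExtTask := ⟨Finset.univ.image fun x => ((φ x).idx, r x), by simp⟩
    have hs : ∀ p ∈ s.1, ∃ x, ((φ x).idx, r x) = p := fun p hp => by
      simpa [s] using hp
    obtain ⟨z, hz⟩ := QU.exists_point_of_task s
      (fun p hp => by
        obtain ⟨x, rfl⟩ := hs p hp
        have : (0 : ℝ) < r x := by rw [← hr]; exact dist_pos.2 x.2.symm
        exact_mod_cast this)
      (fun p hp q hq => by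
        obtain ⟨a, rfl⟩ := hs p hp
        obtain ⟨b, rfl⟩ := hs q hq
        have : (((φ a).ratDist (φ b) : ℚ) : ℝ) ≤ r a + r b := by
          rw [hφd, ← hr, ← hr]; exact dist_triangle_left _ _ _
        exact_mod_cast this)
      (fun p hp q hq => by
        obtain ⟨a, rfl⟩ := hs p hp
        obtain ⟨b, rfl⟩ := hs q hq
        have : ((r a : ℚ) : ℝ) ≤ r b + ((φ b).ratDist (φ a) : ℚ) := by
          rw [hφd, ← hr, ← hr]; exact dist_triangle _ _ _
        exact_mod_cast this)
    refine ⟨z, fun x => ?_⟩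
    rw [QU.dist_eq, hr]
    have := hz ((φ x).idx, r x)
      (Finset.mem_image_of_mem _ (Finset.mem_univ x))
    exact_mod_cast this

/-! ### Spaces of representations and generic representations -/

/-- The permutation group topology on the isometry group of `X`: its basic open sets are
`{g | g x = f x for all x ∈ A}`, with `f` an isometry and `A ⊆ X` finite. -/
instance permutationGroupTopology (X : Type*) [MetricSpace X] : TopologicalSpace (X ≃ᵢ X) :=
  TopologicalSpace.generateFrom
    {V | ∃ (f : X ≃ᵢ X) (A : Finset X), V = {g | ∀ x ∈ A, g x = f x}}

/-- The topology on the space `Rep(Γ, G)` of representations of `Γ` in `G`, as a subspace of the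
product `G ^ Γ`. -/
instance repTopology (Γ G : Type*) [Group Γ] [Group G] [TopologicalSpace G] :
    TopologicalSpace (Γ →* G) :=
  TopologicalSpace.induced (fun (π : Γ →* G) (γ : Γ) => π γ) Pi.topologicalSpace

/-- The orbit of a representation under the diagonal conjugacy action of `G`. -/
def conjOrbit {Γ G : Type*} [Group Γ] [Group G] (π : Γ →* G) : Set (Γ →* G) :=
  {θ | ∃ a : G, ∀ γ : Γ, a * π γ * a⁻¹ = θ γ}

/-- A representation is generic if its orbit is comeagre in the space of representations. -/
def IsGeneric {Γ G : Type*} [Group Γ] [Group G] [TopologicalSpace G] (π : Γ →* G) : Prop :=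
  conjOrbit π ∈ residual (Γ →* G)

/-! ### The profinite topology and property (RZ) -/

/-- The profinite topology on a group, generated by the cosets of finite index normal subgroups. -/
@[reducible]
def profiniteTopology (Γ : Type*) [Group Γ] : TopologicalSpace Γ :=
  TopologicalSpace.generateFrom
    {V | ∃ (g : Γ) (K : Subgroup Γ), K.Normal ∧ K.FiniteIndex ∧ V = g • (K : Set Γ)}

/-- The Ribes–Zalesskiĭ property: every product `H₁ H₂ ⋯ Hₙ` of finitely many finitely generated
subgroups is closed in the profinite topology. -/
def HasPropertyRZ (Γ : Type*) [Group Γ] : Prop :=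
  ∀ L : List (Subgroup Γ), (∀ H ∈ L, H.FG) →
    @IsClosed Γ (profiniteTopology Γ) (L.map fun H => (H : Set Γ)).prod

/-! Call a representation rich (`IsRich`) if its orbits are finite, it has a fixed point, and every
finite equivariant partial isometry into it extends to any finite invariant set containing the
domain. A back-and-forth argument shows that any two rich representations are conjugate
(`IsRich.mem_conjOrbit`). For a finitely generated group with (RZ) the rich representations are
comeagre (`isRich_mem_residual`), so the generic representations are exactly the conjugates of rich
ones. Both claims then follow once the restriction of a rich representation to `Λ` is known to be
rich (`IsRich.restrict`), since `Λ` inherits (RZ).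

Comeagreness rests on two constructions. By `exists_finite_approximation`, every representation
agrees on given finite data with one that factors through a finite quotient. The orbits of finitely
many points are modelled by cosets of finitely generated subgroups with a path metric, and (RZ)
supplies a finite quotient in which no path becomes too short. By `exists_equivariant_amalgam`, a
finite `Q`-space and a finite `Λ`-space with a common part embed in one finite `Q`-space, which
contains the action induced from `Λ` to `Q`. Finite actions embed in `QU` and extend to all of it.

For the restriction, (RZ) also makes a finite index subgroup of `Λ` contain `N ∩ Λ` for some finite
index normal `N` in `Γ`. A finite `Λ`-extension can therefore be induced to a finite `Γ`-extension,
which a rich representation of `Γ` realises. -/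

/-! ### Finite rational pseudometric spaces -/

/-- A rational-valued pseudometric. -/
structure IsPseudo {Y : Type*} (d : Y → Y → ℚ) : Prop where
  refl : ∀ y, d y y = 0
  symm : ∀ y z, d y z = d z y
  tri : ∀ x y z, d x z ≤ d x y + d y z

theorem IsPseudo.nonneg {Y : Type*} {d : Y → Y → ℚ} (h : IsPseudo d) (x y : Y) : 0 ≤ d x y := by
  have h1 := h.tri x y x
  rw [h.refl, h.symm y x] at h1
  linarith

theorem IsPseudo.eq_of_zero {Y : Type*} {d : Y → Y → ℚ} (h : IsPseudo d) {x y : Y}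
    (hxy : d x y = 0) (z : Y) : d x z = d y z := by
  have h1 := h.tri x y z
  have h2 := h.tri y x z
  rw [h.symm y x] at h2
  linarith

/-- The minimum of a rational function on a finite nonempty type. -/
noncomputable def minOver {A : Type*} [Finite A] [Nonempty A] (f : A → ℚ) : ℚ :=
  f (Classical.choose (Finite.exists_min f))

theorem minOver_le {A : Type*} [Finite A] [Nonempty A] (f : A → ℚ) (a : A) : minOver f ≤ f a :=
  Classical.choose_spec (Finite.exists_min f) a

theorem exists_minOver {A : Type*} [Finite A] [Nonempty A] (f : A → ℚ) : ∃ a, minOver f = f a :=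
  ⟨_, rfl⟩

open Classical in
/-- The metric amalgam over `A` of the classes of `r`, where `δ` gives the distances to the points
of `A`. -/
noncomputable def glueDist {Y A : Type*} [Finite A] [Nonempty A] (r : Y → Y → Prop)
    (d : Y → Y → ℚ) (δ : Y → A → ℚ) (y z : Y) : ℚ :=
  if r y z then d y z else minOver fun a => δ y a + δ z a

/-- By `h4` and `h5` each `δ y` behaves like the distances from a point to `A`; `h2` and `h3` make
this compatible with `d` inside a class. If both steps of a triangle change class, their optimal
points `a` and `b` of `A` are compared through `dA a b`. -/
theorem IsPseudo.glue {Y A : Type*} [Finite A] [Nonempty A] {r : Y → Y → Prop}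
    (hr : Equivalence r) {d : Y → Y → ℚ} {dA : A → A → ℚ} {δ : Y → A → ℚ}
    (hrefl : ∀ y, d y y = 0) (hsymm : ∀ y z, r y z → d y z = d z y)
    (htri : ∀ x y z, r x y → r y z → d x z ≤ d x y + d y z)
    (h2 : ∀ y z a, r y z → δ y a ≤ d y z + δ z a)
    (h3 : ∀ y z a, r y z → d y z ≤ δ y a + δ z a)
    (h4 : ∀ y a b, dA a b ≤ δ y a + δ y b)
    (h5 : ∀ y a b, δ y b ≤ δ y a + dA a b) : IsPseudo (glueDist r d δ) where
  refl y := by simp [glueDist, hr.refl y, hrefl]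
  symm y z := by
    by_cases h : r y z
    · simp [glueDist, h, hr.symm h, hsymm y z h]
    · have h' : ¬ r z y := fun h' => h (hr.symm h')
      simp only [glueDist, h, h', if_false]
      congr 1
      funext a
      ring
  tri x y z := by
    by_cases hxy : r x y <;> by_cases hyz : r y z
    · simpa [glueDist, hxy, hyz, hr.trans hxy hyz] using htri x y z hxy hyz
    · have hxz : ¬ r x z := fun h => hyz (hr.trans (hr.symm hxy) h)
      simp only [glueDist, hxy, hyz, hxz, if_true, if_false]
      obtain ⟨a, ha⟩ := exists_minOver fun a => δ y a + δ z a
      have := minOver_le (fun a => δ x a + δ z a) a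
      have := h2 x y a hxy
      beta_reduce at *
      linarith
    · have hxz : ¬ r x z := fun h => hxy (hr.trans h (hr.symm hyz))
      simp only [glueDist, hxy, hyz, hxz, if_true, if_false]
      obtain ⟨a, ha⟩ := exists_minOver fun a => δ x a + δ y a
      have := minOver_le (fun a => δ x a + δ z a) a
      have := h2 z y a (hr.symm hyz)
      have := hsymm y z hyz
      beta_reduce at *
      linarith
    · obtain ⟨a, ha⟩ := exists_minOver fun a => δ x a + δ y a
      obtain ⟨b, hb⟩ := exists_minOver fun a => δ y a + δ z a
      have e1 := h4 y a b
      have e2 := h5 x a b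
      by_cases hxz : r x z
      · simp only [glueDist, hxy, hyz, hxz, if_true, if_false]
        have := h3 x z b hxz
        beta_reduce at *
        linarith
      · simp only [glueDist, hxy, hyz, hxz, if_false]
        have := minOver_le (fun a => δ x a + δ z a) b
        beta_reduce at *
        linarith

/-! ### Amalgamating an induced action with a given action -/

section Induced

variable {Q Λ A T S : Type*} [Group Q] [Group Λ] [MulAction Q A] [MulAction Λ T] (ι : Λ →* Q)
  (dA : A → A → ℚ) (dT : T → T → ℚ) (i : S → A) (j : S → T)

/-- Points of the induced space which lie in the same copy. -/
def indRel (T A : Type*) : (Q × T) ⊕ A → (Q × T) ⊕ A → Prop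
  | .inl y, .inl z => ∃ l, z.1 = y.1 * ι l
  | .inr _, .inr _ => True
  | _, _ => False

open Classical in
/-- The distances inside the copies. -/
noncomputable def indDist : (Q × T) ⊕ A → (Q × T) ⊕ A → ℚ
  | .inl y, .inl z => if h : ∃ l, z.1 = y.1 * ι l then dT y.2 (h.choose • z.2) else 0
  | .inr a, .inr b => dA a b
  | _, _ => 0

/-- The distances to the points of the `Q`-space over which one amalgamates. -/
noncomputable def indDelta [Finite S] [Nonempty S] : (Q × T) ⊕ A → A → ℚ
  | .inl y, a => minOver fun s => dT y.2 (j s) + dA (i s) (y.1⁻¹ • a)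
  | .inr b, a => dA b a

omit [MulAction Q A] [MulAction Λ T] in
theorem indRel_equivalence : Equivalence (indRel ι T A) where
  refl
    | .inl y => ⟨1, by simp⟩
    | .inr _ => trivial
  symm {x y} h := by
    rcases x with x | x <;> rcases y with y | y <;> simp only [indRel] at h ⊢
    obtain ⟨l, hl⟩ := h
    exact ⟨l⁻¹, by simp [hl]⟩
  trans {x y z} h h' := by
    rcases x with x | x <;> rcases y with y | y <;> rcases z with z | z <;>
      simp only [indRel] at h h' ⊢
    obtain ⟨l, hl⟩ := h
    obtain ⟨m, hm⟩ := h'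
    exact ⟨l * m, by simp [hl, hm, mul_assoc]⟩

variable {ι dA dT}

-- The choice in `indDist` is immaterial: two candidates differ by an element of the kernel of `ι`,
-- which acts trivially on `T`.
omit [MulAction Q A] in
theorem indDist_inl (hker : ∀ l, ι l = 1 → ∀ t : T, l • t = t) (q : Q) (l : Λ) (t u : T) :
    indDist ι dA dT (.inl (q, t)) (.inl (q * ι l, u)) = dT t (l • u) := by
  have h : ∃ m, q * ι l = q * ι m := ⟨l, rfl⟩
  have h' := mul_left_cancel h.choose_spec
  have : h.choose • u = l • u := by
    have := hker (l⁻¹ * h.choose) (by rw [map_mul, map_inv, ← h', inv_mul_cancel]) u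
    rwa [mul_smul, inv_smul_eq_iff] at this
  simp only [indDist]
  rw [dif_pos h, this]

variable {i j}

theorem indDelta_inl_le [Finite S] [Nonempty S] (q : Q) (t : T) (a : A) (s : S) :
    indDelta dA dT i j (.inl (q, t)) a ≤ dT t (j s) + dA (i s) (q⁻¹ • a) :=
  minOver_le (fun s => dT t (j s) + dA (i s) (q⁻¹ • a)) s

theorem exists_indDelta_inl [Finite S] [Nonempty S] (q : Q) (t : T) (a : A) :
    ∃ s, indDelta dA dT i j (.inl (q, t)) a = dT t (j s) + dA (i s) (q⁻¹ • a) :=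
  exists_minOver (fun s => dT t (j s) + dA (i s) (q⁻¹ • a))

/-- By `hS`, a path through the common part `S` can be moved from one representative of a copy to
another. By `hij`, paths through different points of `S` can be compared. -/
theorem indDist_isPseudo [Finite A] [Nonempty A] [Finite S] [Nonempty S]
    (hker : ∀ l, ι l = 1 → ∀ t : T, l • t = t)
    (hA : IsPseudo dA) (hT : IsPseudo dT)
    (hQA : ∀ (q : Q) a b, dA (q • a) (q • b) = dA a b)
    (hLT : ∀ (l : Λ) t u, dT (l • t) (l • u) = dT t u)
    (hij : ∀ s s', dA (i s) (i s') = dT (j s) (j s'))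
    (hS : ∀ (l : Λ) s, ∃ s', i s' = ι l • i s ∧ j s' = l • j s) :
    IsPseudo (glueDist (indRel ι T A) (indDist ι dA dT) (indDelta dA dT i j)) := by
  refine IsPseudo.glue (indRel_equivalence ι) (dA := dA) ?_ ?_ ?_ ?_ ?_ ?_ ?_
  · rintro (⟨q, t⟩ | a)
    · have := indDist_inl (dA := dA) (dT := dT) hker q 1 t t
      simpa [hT.refl] using this
    · exact hA.refl a
  · rintro (⟨q, t⟩ | a) (⟨q', t'⟩ | a') h <;> simp only [indRel] at h
    · obtain ⟨l, rfl⟩ := h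
      have := indDist_inl (dA := dA) (dT := dT) hker (q * ι l) l⁻¹ t' t
      rw [map_inv, mul_inv_cancel_right] at this
      rw [this, indDist_inl hker, hT.symm, ← hLT l⁻¹, inv_smul_smul]
    · exact hA.symm a a'
  · rintro (⟨q, t⟩ | a) (⟨q', t'⟩ | a') (⟨q'', t''⟩ | a'') h h' <;> simp only [indRel] at h h'
    · obtain ⟨l, rfl⟩ := h
      obtain ⟨m, rfl⟩ := h'
      have := indDist_inl (dA := dA) (dT := dT) hker q (l * m) t t''
      rw [map_mul, ← mul_assoc] at this
      rw [this, indDist_inl hker, indDist_inl hker, mul_smul, ← hLT l t' (m • t'')]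
      exact hT.tri _ _ _
    · exact hA.tri a a' a''
  · rintro (⟨q, t⟩ | a) (⟨q', t'⟩ | a') b h <;> simp only [indRel] at h
    · obtain ⟨l, rfl⟩ := h
      rw [indDist_inl hker]
      obtain ⟨s, hs⟩ := exists_indDelta_inl (dA := dA) (dT := dT) (i := i) (j := j) (q * ι l) t' b
      obtain ⟨s', hs1, hs2⟩ := hS l s
      have h1 := indDelta_inl_le (dA := dA) (dT := dT) (i := i) (j := j) q t b s'
      have h2 := hT.tri t (l • t') (l • j s)
      have h3 := hQA (ι l) (i s) ((q * ι l)⁻¹ • b)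
      rw [smul_smul, mul_inv_rev, mul_inv_cancel_left] at h3
      rw [mul_inv_rev] at hs
      rw [hs, ← h3]
      rw [hs1, hs2] at h1
      rw [hLT] at h2
      linarith
    · exact hA.tri a a' b
  · rintro (⟨q, t⟩ | a) (⟨q', t'⟩ | a') b h <;> simp only [indRel] at h
    · obtain ⟨l, rfl⟩ := h
      rw [indDist_inl hker]
      obtain ⟨s, hs⟩ := exists_indDelta_inl (dA := dA) (dT := dT) (i := i) (j := j) (q * ι l) t' b
      obtain ⟨s', hs1, hs2⟩ := hS l s
      obtain ⟨s'', h1⟩ := exists_indDelta_inl (dA := dA) (dT := dT) (i := i) (j := j) q t b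
      have h3 := hQA (ι l) (i s) ((q * ι l)⁻¹ • b)
      rw [smul_smul, mul_inv_rev, mul_inv_cancel_left] at h3
      rw [mul_inv_rev] at hs
      rw [hs, h1, ← h3, ← hs1, ← hLT l t', ← hs2]
      have e1 := hA.tri (i s'') (q⁻¹ • b) (i s')
      rw [hij] at e1
      have e2 := hT.tri t (j s'') (l • t')
      have e3 := hT.tri (j s'') (j s') (l • t')
      rw [hT.symm (j s') (l • t')] at e3
      rw [hA.symm (q⁻¹ • b)] at e1
      linarith
    · have := hA.tri a b a'
      rw [hA.symm b a'] at this
      exact this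
  · rintro (⟨q, t⟩ | c) a b
    · obtain ⟨s, hs⟩ := exists_indDelta_inl (dA := dA) (dT := dT) (i := i) (j := j) q t a
      obtain ⟨s', hs'⟩ := exists_indDelta_inl (dA := dA) (dT := dT) (i := i) (j := j) q t b
      rw [hs, hs', ← hQA q⁻¹]
      have e1 := hA.tri (q⁻¹ • a) (i s) (q⁻¹ • b)
      have e2 := hA.tri (i s) (i s') (q⁻¹ • b)
      have e3 := hT.tri (j s) t (j s')
      rw [hA.symm _ (i s)] at e1
      rw [hij] at e2
      rw [hT.symm _ t] at e3
      linarith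
    · have := hA.tri a c b
      rw [hA.symm a c] at this
      exact this
  · rintro (⟨q, t⟩ | c) a b
    · obtain ⟨s, hs⟩ := exists_indDelta_inl (dA := dA) (dT := dT) (i := i) (j := j) q t a
      have h1 := indDelta_inl_le (dA := dA) (dT := dT) (i := i) (j := j) q t b s
      have e1 := hA.tri (i s) (q⁻¹ • a) (q⁻¹ • b)
      rw [hQA] at e1
      linarith
    · exact hA.tri c a b

end Induced

/-- Amalgamation of a finite `Q`-space `A` with a finite `Λ`-space `T` over a common part `S`, to a
finite `Q`-space. -/
theorem exists_equivariant_amalgam.{u, v, w, x, y} {Q : Type u} {Λ : Type v} {A : Type w}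
    {T : Type x} {S : Type y} [Group Q] [Finite Q] [Group Λ]
    [MulAction Q A] [MulAction Λ T] [Finite A] [Nonempty A] [Finite T] [Finite S] [Nonempty S]
    (ι : Λ →* Q) {dA : A → A → ℚ} {dT : T → T → ℚ} (i : S → A) (j : S → T)
    (hker : ∀ l, ι l = 1 → ∀ t : T, l • t = t)
    (hA : IsPseudo dA) (hT : IsPseudo dT)
    (hQA : ∀ (q : Q) a b, dA (q • a) (q • b) = dA a b)
    (hLT : ∀ (l : Λ) t u, dT (l • t) (l • u) = dT t u)
    (hij : ∀ s s', dA (i s) (i s') = dT (j s) (j s'))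
    (hS : ∀ (l : Λ) s, ∃ s', i s' = ι l • i s ∧ j s' = l • j s) :
    ∃ (Y : Type (max u w x)) (_ : Finite Y) (_ : MulAction Q Y) (d : Y → Y → ℚ)
      (eA : A → Y) (eT : T → Y), IsPseudo d ∧ (∀ (q : Q) y z, d (q • y) (q • z) = d y z) ∧
      (∀ a b, d (eA a) (eA b) = dA a b) ∧ (∀ t u, d (eT t) (eT u) = dT t u) ∧
      (∀ (q : Q) a, eA (q • a) = q • eA a) ∧
      (∀ l t, d (ι l • eT t) (eT (l • t)) = 0) ∧
      ∀ s, d (eT (j s)) (eA (i s)) = 0 := by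
  let act : MulAction Q ((Q × T) ⊕ A) :=
    { smul := fun q y => match y with
        | .inl z => .inl (q * z.1, z.2)
        | .inr a => .inr (q • a)
      one_smul := by
        rintro (z | a)
        · exact congrArg Sum.inl (Prod.ext (one_mul _) rfl)
        · exact congrArg Sum.inr (one_smul Q a)
      mul_smul := by
        rintro q q' (z | a)
        · exact congrArg Sum.inl (Prod.ext (mul_assoc _ _ _) rfl)
        · exact congrArg Sum.inr (mul_smul q q' a) }
  have hd := indDist_isPseudo (i := i) (j := j) hker hA hT hQA hLT hij hS
  have hpos := hd.nonneg
  have hinl : ∀ (q : Q) z, q • (.inl z : (Q × T) ⊕ A) = .inl (q * z.1, z.2) := fun _ _ => rfl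
  have hinr : ∀ (q : Q) a, q • (.inr a : (Q × T) ⊕ A) = .inr (q • a) := fun _ _ => rfl
  -- This is the balanced product of `Q` and `T` over `Λ`, glued to `A`. No quotient is taken: `(q *
  -- ι l, t)` and `(q, l • t)` merely have distance zero.
  refine ⟨(Q × T) ⊕ A, inferInstance, act, _, .inr, fun t => .inl (1, t), hd, ?_, ?_, ?_, ?_, ?_,
    ?_⟩
  · have hdelta : ∀ (q : Q) (y : (Q × T) ⊕ A) a, indDelta dA dT i j (q • y) (q • a) = indDelta dA dT i j y a := by
      rintro q (⟨p, t⟩ | b) a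
      · simp [hinl, indDelta, mul_smul]
      · simp [hinr, indDelta, hQA]
    have hmin : ∀ (q : Q) (y z : (Q × T) ⊕ A), minOver (fun a => indDelta dA dT i j (q • y) a +
        indDelta dA dT i j (q • z) a) =
        minOver (fun a => indDelta dA dT i j y a + indDelta dA dT i j z a) := by
      intro q y z
      apply le_antisymm
      · obtain ⟨a, ha⟩ := exists_minOver fun a => indDelta dA dT i j y a + indDelta dA dT i j z a
        rw [ha, ← hdelta q y, ← hdelta q z]
        exact minOver_le (fun a => indDelta dA dT i j (q • y) a +
          indDelta dA dT i j (q • z) a) (q • a)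
      · obtain ⟨a, ha⟩ := exists_minOver fun a => indDelta dA dT i j (q • y) a +
          indDelta dA dT i j (q • z) a
        have h1 := hdelta q y (q⁻¹ • a)
        have h2 := hdelta q z (q⁻¹ • a)
        rw [smul_inv_smul] at h1 h2
        rw [ha, h1, h2]
        exact minOver_le (fun a => indDelta dA dT i j y a + indDelta dA dT i j z a) (q⁻¹ • a)
    intro q y z
    have hrel : indRel ι T A (q • y) (q • z) ↔ indRel ι T A y z := by
      rcases y with y | y <;> rcases z with z | z <;>
        simp [hinl, hinr, indRel, mul_assoc]
    by_cases h : indRel ι T A y z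
    · refine (if_pos (hrel.2 h)).trans (Eq.trans ?_ (if_pos h).symm)
      rcases y with ⟨p, t⟩ | y <;> rcases z with ⟨p', u⟩ | z <;> simp only [indRel] at h
      · obtain ⟨l, rfl⟩ := h
        rw [hinl, hinl, indDist_inl hker]
        dsimp only
        rw [← mul_assoc, indDist_inl hker]
      · exact hQA q y z
    · refine (if_neg fun h' => h (hrel.1 h')).trans (Eq.trans ?_ (if_neg h).symm)
      exact hmin q y z
  · intro a b
    simp [glueDist, indRel, indDist]
  · intro t u
    have := indDist_inl (dA := dA) (dT := dT) hker 1 1 t u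
    rw [map_one, mul_one, one_smul] at this
    have h : indRel ι T A (.inl (1, t)) (.inl (1, u)) := ⟨1, by simp⟩
    simp [glueDist, h, this]
  · intro q a
    rfl
  · intro l t
    have := indDist_inl (dA := dA) (dT := dT) hker (ι l) l⁻¹ t (l • t)
    rw [map_inv, mul_inv_cancel, inv_smul_smul, hT.refl] at this
    have h : indRel ι T A (.inl (ι l, t)) (.inl (1, l • t)) := ⟨l⁻¹, by simp⟩
    simp [glueDist, hinl, h, this]
  · intro s
    refine le_antisymm ?_ (hpos _ _)
    have h1 := minOver_le (fun a => indDelta dA dT i j (.inl ((1 : Q), j s)) a +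
      indDelta dA dT i j (.inr (i s) : (Q × T) ⊕ A) a) (i s)
    have h2 := indDelta_inl_le (dA := dA) (dT := dT) (i := i) (j := j) (1 : Q) (j s) (i s) s
    simp only [inv_one, one_smul, hT.refl, hA.refl] at h2
    have h3 : indDelta dA dT i j (.inr (i s) : (Q × T) ⊕ A) (i s) = 0 := hA.refl _
    refine (if_neg (by simp [indRel])).trans_le ?_
    linarith

/-! ### Finite extensions in the rational Urysohn space -/

theorem QU.isPseudo_ratDist : IsPseudo QU.ratDist where
  refl x := by rw [QU.ratDist, stageDist_self]
  symm x y := by rw [QU.ratDist, QU.ratDist, stageDist_comm, max_comm]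
  tri x y z := by
    have := dist_triangle x y z
    simp only [QU.dist_eq] at this
    exact_mod_cast this

theorem QU.eq_of_ratDist_eq_zero {x y : QU} (h : x.ratDist y = 0) : x = y := by
  apply eq_of_dist_eq_zero
  rw [QU.dist_eq, h, Rat.cast_zero]

instance : Countable QU := QU.isRationalUrysohn.countable

instance : Inhabited QU := ⟨⟨0⟩⟩

theorem QU.exists_extend_point {Y : Type*} {d : Y → Y → ℚ} (hd : IsPseudo d) (s : Finset Y)
    (ψ : Y → QU) (hψ : ∀ y ∈ s, ∀ z ∈ s, (ψ y).ratDist (ψ z) = d y z) (y : Y) :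
    ∃ z : QU, ∀ x ∈ s, z.ratDist (ψ x) = d y x := by
  classical
  rcases s.eq_empty_or_nonempty with rfl | hs
  · exact ⟨default, by simp⟩
  -- Tasks prescribe positive distances, so a point at distance zero from an old one must reuse its
  -- image.
  by_cases h0 : ∃ x ∈ s, d y x = 0
  · obtain ⟨x, hx, hyx⟩ := h0
    exact ⟨ψ x, fun z hz => by rw [hψ x hx z hz, hd.eq_of_zero hyx]⟩
  push Not at h0
  let t : ExtTask := ⟨s.image fun x => ((ψ x).idx, d y x), hs.image _⟩
  have ht : ∀ p ∈ t.1, ∃ x ∈ s, ((ψ x).idx, d y x) = p := fun p hp => by simpa [t] using hp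
  obtain ⟨z, hz⟩ := QU.exists_point_of_task t
    (by
      intro p hp
      obtain ⟨x, hx, rfl⟩ := ht p hp
      exact lt_of_le_of_ne (hd.nonneg _ _) (h0 x hx).symm)
    (by
      intro p hp q hq
      obtain ⟨x, hx, rfl⟩ := ht p hp
      obtain ⟨x', hx', rfl⟩ := ht q hq
      have := hψ x hx x' hx'
      change (ψ x).ratDist (ψ x') ≤ d y x + d y x'
      rw [this, hd.symm y x]
      exact hd.tri _ _ _)
    (by
      intro p hp q hq
      obtain ⟨x, hx, rfl⟩ := ht p hp
      obtain ⟨x', hx', rfl⟩ := ht q hq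
      have := hψ x' hx' x hx
      change d y x ≤ d y x' + (ψ x').ratDist (ψ x)
      rw [this]
      exact hd.tri _ _ _)
  exact ⟨z, fun x hx => hz ((ψ x).idx, d y x) (Finset.mem_image_of_mem _ hx)⟩

/-- Finite pseudometric form of the extension property. -/
theorem QU.exists_extension {Y I : Type*} [Finite Y] {d : Y → Y → ℚ} (hd : IsPseudo d)
    (i : I → Y) (x : I → QU) (hx : ∀ a b, (x a).ratDist (x b) = d (i a) (i b)) :
    ∃ ψ : Y → QU, (∀ y z, (ψ y).ratDist (ψ z) = d y z) ∧ ∀ a, ψ (i a) = x a := by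
  classical
  have := Fintype.ofFinite Y
  -- The choice is harmless: indices with the same image under `i` have values at distance zero.
  let ψ₀ : Y → QU := fun y => if h : ∃ a, i a = y then x h.choose else default
  have hψ₀ : ∀ a, ψ₀ (i a) = x a := fun a => by
    have h : ∃ b, i b = i a := ⟨a, rfl⟩
    simp only [ψ₀, dif_pos h]
    apply QU.eq_of_ratDist_eq_zero
    rw [hx, h.choose_spec, hd.refl]
  let s : Finset Y := Finset.univ.filter fun y => ∃ a, i a = y
  have key : ∀ t : Finset Y, ∃ ψ : Y → QU,
      (∀ y ∈ s ∪ t, ∀ z ∈ s ∪ t, (ψ y).ratDist (ψ z) = d y z) ∧ ∀ y ∈ s, ψ y = ψ₀ y := by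
    intro t
    induction t using Finset.induction_on with
    | empty =>
      refine ⟨ψ₀, fun y hy z hz => ?_, fun _ _ => rfl⟩
      simp only [Finset.union_empty, s, Finset.mem_filter, Finset.mem_univ, true_and] at hy hz
      obtain ⟨a, rfl⟩ := hy
      obtain ⟨b, rfl⟩ := hz
      rw [hψ₀, hψ₀, hx]
    | insert y t _ ih =>
      obtain ⟨ψ, h1, h2⟩ := ih
      by_cases hy : y ∈ s ∪ t
      · refine ⟨ψ, ?_, h2⟩
        rwa [Finset.union_insert, Finset.insert_eq_of_mem hy]
      obtain ⟨z, hz⟩ := QU.exists_extend_point hd (s ∪ t) ψ h1 y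
      have hne : ∀ w ∈ s ∪ t, w ≠ y := fun w hw h => hy (h ▸ hw)
      refine ⟨Function.update ψ y z, ?_, fun w hw => ?_⟩
      · rw [Finset.union_insert]
        intro a ha b hb
        rcases Finset.mem_insert.1 ha with ha' | ha' <;>
          rcases Finset.mem_insert.1 hb with hb' | hb'
        · rw [ha', hb', hd.refl, QU.isPseudo_ratDist.refl]
        · rw [ha', Function.update_self, Function.update_of_ne (hne b hb'), hz b hb']
        · rw [hb', Function.update_self, Function.update_of_ne (hne a ha'),
            QU.isPseudo_ratDist.symm, hz a ha', hd.symm]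
        · rw [Function.update_of_ne (hne a ha'), Function.update_of_ne (hne b hb'), h1 a ha' b hb']
      · rw [Function.update_of_ne (hne w (Finset.mem_union_left _ hw)), h2 w hw]
  obtain ⟨ψ, h1, h2⟩ := key Finset.univ
  refine ⟨ψ, fun y z => h1 y (by simp) z (by simp), fun a => ?_⟩
  rw [h2 _ (by simp [s]), hψ₀]

/-- The map `ρ` defines an isometric action of `Q` on the subset `S` of the rational Urysohn
space. -/
structure IsActOn {Q : Type*} [Group Q] (ρ : Q → QU → QU) (S : Set QU) : Prop where
  maps : ∀ q, ∀ x ∈ S, ρ q x ∈ S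
  one : ∀ x ∈ S, ρ 1 x = x
  mul : ∀ q q', ∀ x ∈ S, ρ (q * q') x = ρ q (ρ q' x)
  isom : ∀ q, ∀ x ∈ S, ∀ y ∈ S, (ρ q x).ratDist (ρ q y) = x.ratDist y

/-- The action on the points of a set on which `ρ` acts. -/
@[reducible]
def IsActOn.mulAction {Q : Type*} [Group Q] {ρ : Q → QU → QU} {S : Set QU} (h : IsActOn ρ S) :
    MulAction Q S where
  smul q x := ⟨ρ q x, h.maps q x x.2⟩
  one_smul x := Subtype.ext (h.one x x.2)
  mul_smul q q' x := Subtype.ext (h.mul q q' x x.2)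

/-- Finite pseudometric `Q`-spaces embed in the rational Urysohn space, with prescribed values on
a part of them. -/
theorem QU.exists_equivariant_extension {Q Y I : Type*} [Group Q] [MulAction Q Y] [Finite Y]
    {d : Y → Y → ℚ} (hd : IsPseudo d) (hQ : ∀ (q : Q) y z, d (q • y) (q • z) = d y z)
    (i : I → Y) (x : I → QU) (hx : ∀ a b, (x a).ratDist (x b) = d (i a) (i b)) :
    ∃ (ψ : Y → QU) (ρ : Q → QU → QU), (∀ y z, (ψ y).ratDist (ψ z) = d y z) ∧
      (∀ a, ψ (i a) = x a) ∧ IsActOn ρ (Set.range ψ) ∧ ∀ q y, ρ q (ψ y) = ψ (q • y) := by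
  classical
  obtain ⟨ψ, h1, h2⟩ := QU.exists_extension hd i x hx
  let ρ : Q → QU → QU := fun q z => if h : ∃ y, ψ y = z then ψ (q • h.choose) else z
  have hρ : ∀ q y, ρ q (ψ y) = ψ (q • y) := fun q y => by
    have h : ∃ z, ψ z = ψ y := ⟨y, rfl⟩
    simp only [ρ, dif_pos h]
    apply QU.eq_of_ratDist_eq_zero
    rw [h1, hQ, ← h1, h.choose_spec, QU.isPseudo_ratDist.refl]
  refine ⟨ψ, ρ, h1, h2, ⟨?_, ?_, ?_, ?_⟩, hρ⟩
  · rintro q _ ⟨y, rfl⟩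
    exact ⟨_, (hρ q y).symm⟩
  · rintro _ ⟨y, rfl⟩
    rw [hρ, one_smul]
  · rintro q q' _ ⟨y, rfl⟩
    rw [hρ, hρ, hρ, mul_smul]
  · rintro q _ ⟨y, rfl⟩ _ ⟨z, rfl⟩
    rw [hρ, hρ, h1, h1, hQ]

/-! ### Extending actions of finite groups to the rational Urysohn space -/

/-- Meets countably many dense requirements along one chain; it drives both limit constructions
below. -/
theorem exists_monotone_seq {P : Type*} [Preorder P] (p : P) {D : ℕ → P → Prop}
    (h : ∀ n p, ∃ q, p ≤ q ∧ D n q) :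
    ∃ f : ℕ → P, Monotone f ∧ p ≤ f 0 ∧ ∀ n, D n (f (n + 1)) := by
  choose g hg using h
  let f : ℕ → P := fun n => Nat.rec p (fun n q => g n q) n
  exact ⟨f, monotone_nat_of_le_succ fun n => (hg n (f n)).1, le_rfl, fun n => (hg n (f n)).2⟩

theorem isometry_ratDist (g : QU ≃ᵢ QU) (x y : QU) : (g x).ratDist (g y) = x.ratDist y := by
  have := g.isometry.dist_eq x y
  rw [QU.dist_eq, QU.dist_eq] at this
  exact_mod_cast this

theorem isometry_of_ratDist {f : QU → QU} (h : ∀ x y, (f x).ratDist (f y) = x.ratDist y) :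
    Isometry f :=
  Isometry.of_dist_eq fun x y => by rw [QU.dist_eq, QU.dist_eq, h]

section

variable {Q : Type*} [Group Q]

theorem IsActOn.exists_hom {ρ : Q → QU → QU} (h : IsActOn ρ Set.univ) :
    ∃ π : Q →* (QU ≃ᵢ QU), ∀ q x, π q x = ρ q x := by
  have hinv : ∀ q x, ρ q (ρ q⁻¹ x) = x := fun q x => by
    rw [← h.mul q q⁻¹ x trivial, mul_inv_cancel, h.one x trivial]
  let e : Q → (QU ≃ᵢ QU) := fun q => IsometryEquiv.mk' (ρ q) (ρ q⁻¹) (hinv q)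
    (isometry_of_ratDist fun x y => h.isom q x trivial y trivial)
  exact ⟨MonoidHom.mk' e fun q q' => IsometryEquiv.ext fun x => h.mul q q' x trivial,
    fun _ _ => rfl⟩

/-- Amalgamating `S` with `insert x S`, on which the trivial group acts, attaches one copy of `x`
over `S` for each element of `Q`, permuted by translation. -/
theorem IsActOn.exists_insert [Finite Q] {ρ : Q → QU → QU} {S : Set QU} (h : IsActOn ρ S)
    (hS : S.Finite) (hne : S.Nonempty) (x : QU) :
    ∃ (ρ' : Q → QU → QU) (S' : Set QU), S'.Finite ∧ S ⊆ S' ∧ x ∈ S' ∧ IsActOn ρ' S' ∧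
      ∀ q, ∀ y ∈ S, ρ' q y = ρ q y := by
  let := h.mulAction
  have : Finite S := hS
  have : Nonempty S := hne.to_subtype
  have : Finite ↑(insert x S) := hS.insert x
  let : MulAction Unit ↑(insert x S) :=
    { smul := fun _ y => y, one_smul := fun _ => rfl, mul_smul := fun _ _ _ => rfl }
  have hu : ∀ (l : Unit) (y : ↑(insert x S)), l • y = y := fun _ _ => rfl
  have hp := QU.isPseudo_ratDist
  have hpS : ∀ U : Set QU, IsPseudo fun a b : U => a.1.ratDist b.1 := fun U =>
    ⟨fun _ => hp.refl _, fun _ _ => hp.symm _ _, fun _ _ _ => hp.tri _ _ _⟩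
  obtain ⟨Y, _, _, d, eA, eT, hd, hQ, hA, hT, hsmul, -, hglue⟩ :=
    exists_equivariant_amalgam (S := S) (A := S) (T := ↑(insert x S)) (1 : Unit →* Q)
    (dA := fun a b => a.1.ratDist b.1) (dT := fun a b => a.1.ratDist b.1)
    id (fun s => ⟨s, Set.mem_insert_of_mem _ s.2⟩) (fun l _ t => hu l t) (hpS _) (hpS _)
    (fun q a b => h.isom q a a.2 b b.2) (fun _ _ _ => rfl) (fun _ _ => rfl)
    (fun l s => ⟨s, by simp, by rw [hu]⟩)
  obtain ⟨ψ, ρ', hψ, hψT, hact, hρ'⟩ := QU.exists_equivariant_extension hd hQ eT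
    (fun t => (t : QU)) fun a b => (hT a b).symm
  have hψA : ∀ s : S, ψ (eA s) = s := fun s => by
    rw [← hψT ⟨s, Set.mem_insert_of_mem _ s.2⟩]
    apply QU.eq_of_ratDist_eq_zero
    rw [hψ, hd.symm]
    exact hglue s
  refine ⟨ρ', Set.range ψ, Set.finite_range ψ, fun s hs => ⟨_, hψA ⟨s, hs⟩⟩,
    ⟨_, hψT ⟨x, Set.mem_insert _ _⟩⟩, hact, fun q y hy => ?_⟩
  have := hρ' q (eA ⟨y, hy⟩)
  rw [hψA, ← hsmul, hψA] at this
  exact this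

theorem IsActOn.exists_extending_hom [Finite Q] {ρ : Q → QU → QU} {S : Set QU} (h : IsActOn ρ S)
    (hS : S.Finite) (hne : S.Nonempty) :
    ∃ π : Q →* (QU ≃ᵢ QU), ∀ q, ∀ x ∈ S, π q x = ρ q x := by
  let P := {p : (Q → QU → QU) × Set QU // p.2.Finite ∧ p.2.Nonempty ∧ IsActOn p.1 p.2}
  let : Preorder P :=
    { le := fun p p' => p.1.2 ⊆ p'.1.2 ∧ ∀ q, ∀ x ∈ p.1.2, p'.1.1 q x = p.1.1 q x
      le_refl := fun p => ⟨subset_rfl, fun _ _ _ => rfl⟩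
      le_trans := fun p p' p'' h h' => ⟨h.1.trans h'.1, fun q x hx => by
        rw [h'.2 q x (h.1 hx), h.2 q x hx]⟩ }
  obtain ⟨f, hf, h0, hD⟩ := exists_monotone_seq (P := P) ⟨(ρ, S), hS, hne, h⟩
    (D := fun n p => (⟨n⟩ : QU) ∈ p.1.2) (by
      rintro n ⟨⟨ρ, S⟩, hS, hne, h⟩
      obtain ⟨ρ', S', h1, h2, h3, h4, h5⟩ := h.exists_insert hS hne ⟨n⟩
      exact ⟨⟨(ρ', S'), h1, hne.mono h2, h4⟩, ⟨h2, h5⟩, h3⟩)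
  -- The requirement numbered `x.idx` is met at stage `x.idx + 1`, where `x` is already in the
  -- domain.
  let σ : Q → QU → QU := fun q x => (f (x.idx + 1)).1.1 q x
  have hmem : ∀ x : QU, ∀ n, x.idx < n → x ∈ (f n).1.2 := fun x n hn => (hf hn).1 (hD x.idx)
  have hσ : ∀ n q, ∀ x ∈ (f n).1.2, σ q x = (f n).1.1 q x := fun n q x hx => by
    rcases le_total n (x.idx + 1) with hn | hn
    · exact (hf hn).2 q x hx
    · exact ((hf hn).2 q x (hmem x _ (Nat.lt_succ_self _))).symm
  have hσ' : IsActOn σ Set.univ := by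
    refine ⟨fun _ _ _ => trivial, fun x _ => ?_, fun q q' x _ => ?_, fun q x _ y _ => ?_⟩
    · exact (f (x.idx + 1)).2.2.2.one x (hmem x _ (Nat.lt_succ_self _))
    · have hx := hmem x _ (Nat.lt_succ_self _)
      have hact := (f (x.idx + 1)).2.2.2
      rw [hσ _ _ x hx, hσ _ _ x hx, hact.mul q q' x hx, hσ _ q _ (hact.maps q' x hx)]
    · have hx := hmem x (x.idx + y.idx + 1) (by omega)
      have hy := hmem y (x.idx + y.idx + 1) (by omega)
      rw [hσ _ _ x hx, hσ _ _ y hy]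
      exact (f _).2.2.2.isom q x hx y hy
  obtain ⟨π, hπ⟩ := hσ'.exists_hom
  exact ⟨π, fun q x hx => by rw [hπ, hσ 0 q x (h0.1 hx)]; exact h0.2 q x hx⟩

/-- A new point at constant distance `K`, at least the diameter of `S`, can be fixed by all of `Q`.
Such a point later starts the back-and-forth, where partial isometries must be nonempty. -/
theorem IsActOn.exists_extending_hom_fixing [Finite Q] {ρ : Q → QU → QU} {S : Set QU}
    (h : IsActOn ρ S) (hS : S.Finite) :
    ∃ π : Q →* (QU ≃ᵢ QU), (∀ q, ∀ x ∈ S, π q x = ρ q x) ∧ ∃ z, ∀ q, π q z = z := by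
  classical
  obtain ⟨K, hK, hKS⟩ : ∃ K : ℚ, 0 < K ∧ ∀ x ∈ S, ∀ y ∈ S, x.ratDist y ≤ K := by
    obtain ⟨K, hK⟩ := (hS.prod hS).image (fun p : QU × QU => p.1.ratDist p.2) |>.bddAbove
    exact ⟨max K 1, by positivity, fun x hx y hy =>
      (hK ⟨(x, y), ⟨hx, hy⟩, rfl⟩).trans (le_max_left _ _)⟩
  have hp := QU.isPseudo_ratDist
  have hopt : IsPseudo (Y := Option S) fun a b => match a, b with
      | some a, some b => a.1.ratDist b
      | none, none => 0
      | _, _ => K := by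
    refine ⟨?_, ?_, ?_⟩
    · rintro (_ | a)
      · rfl
      · exact hp.refl _
    · rintro (_ | a) (_ | b)
      · rfl
      · rfl
      · rfl
      · exact hp.symm _ _
    · rintro (_ | a) (_ | b) (_ | c) <;> dsimp only
      · norm_num
      · linarith
      · linarith
      · linarith [hp.nonneg b.1 c.1]
      · linarith
      · linarith [hKS _ a.2 _ c.2]
      · linarith [hp.nonneg a.1 b.1]
      · exact hp.tri _ _ _
  have : Finite S := hS
  obtain ⟨ψ, hψ, hψS⟩ := QU.exists_extension hopt some (fun s : S => (s : QU)) fun _ _ => rfl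
  have hz : ∀ x ∈ S, (ψ none).ratDist x = K := fun x hx => by
    have := hψ none (some ⟨x, hx⟩)
    rwa [hψS] at this
  have hzS : ψ none ∉ S := fun h => hK.ne' (by rw [← hz _ h, hp.refl])
  have hne : ∀ x ∈ S, x ≠ ψ none := fun x hx h => hzS (h ▸ hx)
  let ρ' : Q → QU → QU := fun q x => if x = ψ none then x else ρ q x
  have h1 : ∀ q, ρ' q (ψ none) = ψ none := fun q => if_pos rfl
  have h2 : ∀ q, ∀ x ∈ S, ρ' q x = ρ q x := fun q x hx => if_neg (hne x hx)
  have hact : IsActOn ρ' (insert (ψ none) S) := by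
    refine ⟨?_, ?_, ?_, ?_⟩
    · rintro q x (rfl | hx)
      · rw [h1]; exact Set.mem_insert _ _
      · rw [h2 q x hx]; exact Set.mem_insert_of_mem _ (h.maps q x hx)
    · rintro x (rfl | hx)
      · rw [h1]
      · rw [h2 _ x hx, h.one x hx]
    · rintro q q' x (rfl | hx)
      · rw [h1, h1, h1]
      · rw [h2 _ x hx, h2 _ x hx, h2 q _ (h.maps q' x hx), h.mul q q' x hx]
    · rintro q x (rfl | hx) y (rfl | hy)
      · rw [h1]
      · rw [h1, h2 q y hy, hz _ (h.maps q y hy), hz _ hy]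
      · rw [h1, h2 q x hx, hp.symm, hz _ (h.maps q x hx), hp.symm, hz _ hx]
      · rw [h2 q x hx, h2 q y hy, h.isom q x hx y hy]
  obtain ⟨π, hπ⟩ := hact.exists_extending_hom (hS.insert _) ⟨_, Set.mem_insert _ _⟩
  refine ⟨π, fun q x hx => ?_, ψ none, fun q => ?_⟩
  · rw [hπ q x (Set.mem_insert_of_mem _ hx), h2 q x hx]
  · rw [hπ q _ (Set.mem_insert _ _), h1]

end

/-! ### The profinite topology -/

theorem Subgroup.FG.map_hom {G G' : Type*} [Group G] [Group G'] {H : Subgroup G} (hH : H.FG)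
    (f : G →* G') : (H.map f).FG := by
  obtain ⟨S, hS, hS'⟩ := (Subgroup.fg_iff H).1 hH
  exact (Subgroup.fg_iff _).2 ⟨f '' S, by rw [← hS, MonoidHom.map_closure], hS'.image f⟩

section Profinite

variable {Γ : Type*} [Group Γ]

theorem isOpen_profinite_iff {U : Set Γ} : @IsOpen Γ (profiniteTopology Γ) U ↔
    ∀ z ∈ U, ∃ N : Subgroup Γ, N.Normal ∧ N.FiniteIndex ∧ ∀ n ∈ N, z * n ∈ U := by
  constructor
  · intro h
    induction h with
    | basic V hV =>
      obtain ⟨g, K, hK, hK', rfl⟩ := hV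
      rintro z hz
      rw [mem_leftCoset_iff] at hz
      refine ⟨K, hK, hK', fun n hn => ?_⟩
      rw [mem_leftCoset_iff, ← mul_assoc]
      exact K.mul_mem hz hn
    | univ => exact fun z _ => ⟨⊤, inferInstance, inferInstance, fun _ _ => trivial⟩
    | inter V W _ _ ihV ihW =>
      rintro z ⟨hV, hW⟩
      obtain ⟨N, hN, hN', h⟩ := ihV z hV
      obtain ⟨K, hK, hK', h'⟩ := ihW z hW
      exact ⟨N ⊓ K, inferInstance, inferInstance, fun n hn => ⟨h n hn.1, h' n hn.2⟩⟩
    | sUnion 𝒱 _ ih =>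
      rintro z ⟨V, hV, hz⟩
      obtain ⟨N, hN, hN', h⟩ := ih V hV z hz
      exact ⟨N, hN, hN', fun n hn => ⟨V, hV, h n hn⟩⟩
  · intro h
    let := profiniteTopology Γ
    refine isOpen_iff_forall_mem_open.2 fun z hz => ?_
    obtain ⟨N, hN, hN', hU⟩ := h z hz
    refine ⟨z • (N : Set Γ), fun u hu => ?_,
      TopologicalSpace.isOpen_generateFrom_of_mem ⟨z, N, hN, hN', rfl⟩, ?_⟩
    · rw [mem_leftCoset_iff] at hu
      simpa using hU _ hu
    · rw [mem_leftCoset_iff]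
      simp [N.one_mem]

theorem hasPropertyRZ_iff : HasPropertyRZ Γ ↔ ∀ L : List (Subgroup Γ), (∀ H ∈ L, H.FG) →
    @IsClosed Γ (profiniteTopology Γ) (L.map fun H : Subgroup Γ => (H : Set Γ)).prod := by
  have : ∀ L : List (Subgroup Γ), (do let a ← L; pure (a : Set Γ)) =
      L.map fun H : Subgroup Γ => (H : Set Γ) := fun L => List.map_eq_flatMap.symm
  simp only [HasPropertyRZ, this, List.map_id']

/-- The empty set, and right translates of products of finitely generated subgroups. -/
def IsCosetProduct (P : Set Γ) : Prop :=
  P = ∅ ∨ ∃ (L : List (Subgroup Γ)) (t : Γ), (∀ H ∈ L, H.FG) ∧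
    ∀ u, u ∈ P ↔ u * t⁻¹ ∈ (L.map fun H : Subgroup Γ => (H : Set Γ)).prod

theorem IsCosetProduct.exists_separating (hΓ : HasPropertyRZ Γ) {P : Set Γ}
    (hP : IsCosetProduct P) {z : Γ} (hz : z ∉ P) :
    ∃ N : Subgroup Γ, N.Normal ∧ N.FiniteIndex ∧ ∀ n ∈ N, z * n ∉ P := by
  rcases hP with rfl | ⟨L, t, hL, hP⟩
  · exact ⟨⊤, inferInstance, inferInstance, fun _ _ h => h⟩
  obtain ⟨N, hN, hN', h⟩ := isOpen_profinite_iff.1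
    (@IsClosed.isOpen_compl _ (profiniteTopology Γ) _ (hasPropertyRZ_iff.1 hΓ L hL)) (z * t⁻¹)
    (fun h => hz ((hP z).2 h))
  refine ⟨N, hN, hN', fun n hn hn' => h (t * n * t⁻¹) (hN.conj_mem n hn t) ?_⟩
  rw [hP] at hn'
  convert hn' using 1
  group

theorem IsCosetProduct.of_subgroup {H : Subgroup Γ} (hH : H.FG) : IsCosetProduct (H : Set Γ) :=
  Or.inr ⟨[H], 1, by simpa using hH, by simp⟩

/-- If `P` is a product of subgroups times `t`, then appending `s` and `H` amounts to appending the
conjugate of `H` by `t * s` and translating by `t * s`. -/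
theorem IsCosetProduct.mul_coset {P : Set Γ} (hP : IsCosetProduct P) (s : Γ) {H : Subgroup Γ}
    (hH : H.FG) : IsCosetProduct {u | ∃ v ∈ P, ∃ h ∈ H, u = v * s * h} := by
  rcases hP with rfl | ⟨L, t, hL, hP⟩
  · exact Or.inl (by simp)
  refine Or.inr ⟨L ++ [H.map (MulAut.conj (t * s)).toMonoidHom], t * s, ?_, fun u => ?_⟩
  · intro K hK
    rw [List.mem_append, List.mem_singleton] at hK
    rcases hK with hK | rfl
    · exact hL K hK
    · exact hH.map_hom _
  · simp only [List.map_append, List.prod_append, List.map_cons, List.map_nil, List.prod_cons,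
      List.prod_nil, mul_one, Set.mem_mul, Set.mem_ofPred_eq]
    constructor
    · rintro ⟨v, hv, h, hh, rfl⟩
      refine ⟨v * t⁻¹, (hP v).1 hv, _, ⟨h, hh, rfl⟩, ?_⟩
      simp only [MulEquiv.coe_toMonoidHom, MulAut.conj_apply]
      group
    · rintro ⟨p, hp, _, ⟨h, hh, rfl⟩, hu⟩
      refine ⟨p * t, (hP _).2 (by simpa using hp), h, hh, ?_⟩
      rw [mul_inv_eq_iff_eq_mul.1 hu.symm]
      simp only [MulEquiv.coe_toMonoidHom, MulAut.conj_apply]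
      group

end Profinite

/-! ### Paths in coset spaces -/

section Path

variable {Γ I : Type*} [Group Γ] (g : I → Γ) (r : I → I) (H : I → Subgroup Γ) (ω : I → I → ℕ)

/-- The group elements which can be reached by a path through a given list of edges, read
backwards. -/
def pathSet : List (I × I) → I → I → Set Γ
  | [], c, c' => {u | c = c' ∧ u ∈ H c}
  | e :: l, c, c' => {u | r e.2 = c' ∧ 0 < ω e.1 e.2 ∧ ∃ v ∈ pathSet l c (r e.1), ∃ h ∈ H c',
      u = v * ((g e.1)⁻¹ * g e.2) * h}

/-- The weight of a list of edges. -/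
def pathWeight (l : List (I × I)) : ℕ := (l.map fun e => ω e.1 e.2).sum

variable {g r H ω}

/-- A composable edge list yields an alternating product of the subgroups and fixed elements; any
other list yields the empty set. -/
theorem isCosetProduct_pathSet (hH : ∀ c, (H c).FG) (l : List (I × I)) (c c' : I) :
    IsCosetProduct (pathSet g r H ω l c c') := by
  induction l generalizing c' with
  | nil =>
    by_cases h : c = c'
    · subst h
      simpa [pathSet] using IsCosetProduct.of_subgroup (hH c)
    · exact Or.inl (by simp [pathSet, h])
  | cons e l ih =>
    by_cases h : r e.2 = c' ∧ 0 < ω e.1 e.2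
    · simpa [pathSet, h] using (ih (r e.1)).mul_coset ((g e.1)⁻¹ * g e.2) (hH c')
    · refine Or.inl (Set.eq_empty_of_forall_notMem fun u hu => h ⟨hu.1, hu.2.1⟩)

theorem pathSet_append {l l' : List (I × I)} {c c' c'' : I} {u v : Γ}
    (hu : u ∈ pathSet g r H ω l c c') (hv : v ∈ pathSet g r H ω l' c' c'') :
    u * v ∈ pathSet g r H ω (l' ++ l) c c'' := by
  induction l' generalizing c'' v with
  | nil =>
    obtain ⟨rfl, hv⟩ := hv
    cases l with
    | nil =>
      obtain ⟨rfl, hu⟩ := hu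
      exact ⟨rfl, mul_mem hu hv⟩
    | cons e l =>
      obtain ⟨h1, h2, w, hw, h, hh, rfl⟩ := hu
      exact ⟨h1, h2, w, hw, h * v, mul_mem hh hv, by rw [mul_assoc _ h v]⟩
  | cons e l' ih =>
    obtain ⟨h1, h2, w, hw, h, hh, rfl⟩ := hv
    exact ⟨h1, h2, u * w, ih hw, h, hh, by simp only [mul_assoc]⟩

theorem pathWeight_append (l l' : List (I × I)) :
    pathWeight ω (l ++ l') = pathWeight ω l + pathWeight ω l' := by
  simp [pathWeight]

/-- Edges have positive integer weight. A weight bound therefore leaves finitely many edge lists,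
hence finitely many coset products to separate from. -/
theorem length_le_pathWeight {l : List (I × I)} {c c' : I} {u : Γ}
    (hu : u ∈ pathSet g r H ω l c c') : l.length ≤ pathWeight ω l := by
  induction l generalizing c' u with
  | nil => simp
  | cons e l ih =>
    obtain ⟨-, h2, w, hw, -⟩ := hu
    have := ih hw
    simp only [pathWeight, List.map_cons, List.sum_cons, List.length_cons] at this ⊢
    omega

variable {Q : Type*} [Group Q] (g r H ω) (f : Γ →* Q) (M : ℕ)

/-- The length of a shortest directed path, bounded by `M`. -/
noncomputable def pathDist (y z : Q × I) : ℕ :=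
  sInf {n | M ≤ n ∨ ∃ l, pathWeight ω l ≤ n ∧ ∃ u ∈ pathSet g r H ω l y.2 z.2,
    f u = y.1⁻¹ * z.1}

variable {g r H ω f M}

theorem pathDist_le_iff {y z : Q × I} {n : ℕ} : pathDist g r H ω f M y z ≤ n ↔
    M ≤ n ∨ ∃ l, pathWeight ω l ≤ n ∧ ∃ u ∈ pathSet g r H ω l y.2 z.2, f u = y.1⁻¹ * z.1 := by
  constructor
  · intro h
    have h' : pathDist g r H ω f M y z ∈ _ := Nat.sInf_mem ⟨M, Or.inl le_rfl⟩
    rcases h' with h' | ⟨l, hl, h'⟩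
    · exact Or.inl (h'.trans h)
    · exact Or.inr ⟨l, hl.trans h, h'⟩
  · exact fun h => Nat.sInf_le h

theorem pathDist_eq_zero {c : I} {q : Q} {u : Γ} (hu : u ∈ H c) :
    pathDist g r H ω f M (q, c) (q * f u, c) = 0 :=
  Nat.le_zero.1 (pathDist_le_iff.2 (Or.inr ⟨[], by simp [pathWeight], u, ⟨rfl, hu⟩, by simp⟩))

theorem pathDist_triangle (x y z : Q × I) :
    pathDist g r H ω f M x z ≤ pathDist g r H ω f M x y + pathDist g r H ω f M y z := by
  rcases pathDist_le_iff.1 (le_refl (pathDist g r H ω f M x y)) with h | ⟨l, hl, u, hu, hu'⟩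
  · exact pathDist_le_iff.2 (Or.inl (h.trans (Nat.le_add_right _ _)))
  rcases pathDist_le_iff.1 (le_refl (pathDist g r H ω f M y z)) with h | ⟨l', hl', v, hv, hv'⟩
  · exact pathDist_le_iff.2 (Or.inl (h.trans (Nat.le_add_left _ _)))
  refine pathDist_le_iff.2 (Or.inr ⟨l' ++ l, ?_, u * v, pathSet_append hu hv, ?_⟩)
  · rw [pathWeight_append]
    omega
  · rw [map_mul, hu', hv']
    group

theorem pathDist_smul (q : Q) (y z : Q × I) :
    pathDist g r H ω f M (q * y.1, y.2) (q * z.1, z.2) = pathDist g r H ω f M y z := by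
  have : (q * y.1)⁻¹ * (q * z.1) = y.1⁻¹ * z.1 := by group
  simp only [pathDist, this]

/-- `pathDist` is directed, so the maximum of both directions is taken; dividing by `D` undoes the
scaling of the distances to integers. -/
theorem pathDist_isPseudo (D : ℕ) : IsPseudo fun y z : Q × I =>
    ((max (pathDist g r H ω f M y z) (pathDist g r H ω f M z y) : ℕ) : ℚ) / D where
  refl y := by
    have : pathDist g r H ω f M y y = 0 := by
      simpa using pathDist_eq_zero (g := g) (r := r) (ω := ω) (f := f) (M := M) (q := y.1)
        (H := H) (one_mem (H y.2))
    simp [this]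
  symm y z := by rw [max_comm]
  tri x y z := by
    rw [← add_div]
    gcongr
    have h1 := pathDist_triangle (g := g) (r := r) (H := H) (ω := ω) (f := f) (M := M) x y z
    have h2 := pathDist_triangle (g := g) (r := r) (H := H) (ω := ω) (f := f) (M := M) z y x
    norm_cast
    omega

end Path

/-! ### Approximating actions by actions of finite groups -/

theorem exists_common_denominator {J : Type*} [Finite J] (q : J → ℚ) (hq : ∀ j, 0 ≤ q j) :
    ∃ (D : ℕ) (n : J → ℕ), 0 < D ∧ ∀ j, q j = n j / D := by
  have := Fintype.ofFinite J
  have hD : (0 : ℚ) < (∏ j, (q j).den : ℕ) := by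
    exact_mod_cast Finset.prod_pos fun j _ => (q j).den_pos
  have : ∀ j, ∃ n : ℕ, q j = n / (∏ j, (q j).den : ℕ) := fun j => by
    obtain ⟨k, hk⟩ := Finset.dvd_prod_of_mem (fun j => (q j).den) (Finset.mem_univ j)
    refine ⟨(q j).num.toNat * k, ?_⟩
    rw [eq_div_iff hD.ne', hk]
    have h1 : (((q j).num.toNat : ℤ) : ℚ) = (q j).num := by
      rw [Int.toNat_of_nonneg (Rat.num_nonneg.2 (hq j))]
    push_cast at h1 ⊢
    rw [h1, ← mul_assoc, Rat.mul_den_eq_num]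
  choose n hn using this
  exact ⟨_, n, Nat.cast_pos.1 hD, hn⟩

section Approx

variable {Γ I : Type*} [Group Γ]

/-- Each edge is a translate of a genuine distance in `QU`, so the triangle inequality bounds the
distance of the endpoints by the path weight. -/
theorem le_pathWeight {g : Γ → QU → QU} {t : I → Γ} {r : I → I} {H : I → Subgroup Γ}
    {ω : I → I → ℕ} {D : ℕ} {x : I → QU} (hD : 0 < D)
    (hmul : ∀ γ δ y, g (γ * δ) y = g γ (g δ y))
    (hisom : ∀ γ y z, (g γ y).ratDist (g γ z) = y.ratDist z)
    (ht : ∀ a, g (t a) (x (r a)) = x a) (hH : ∀ c, ∀ h ∈ H c, g h (x c) = x c)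
    (hω : ∀ a b, (x a).ratDist (x b) = ω a b / D) {l : List (I × I)} {c c' : I} {u : Γ}
    (hu : u ∈ pathSet t r H ω l c c') :
    (x c).ratDist (g u (x c')) ≤ pathWeight ω l / D := by
  have hp := QU.isPseudo_ratDist
  induction l generalizing c' u with
  | nil =>
    obtain ⟨rfl, hu⟩ := hu
    rw [hH c u hu, hp.refl]
    positivity
  | cons e l ih =>
    obtain ⟨rfl, -, v, hv, h, hh, rfl⟩ := hu
    have h1 := ih hv
    have h2 := hp.tri (x c) (g v (x (r e.1))) (g (v * ((t e.1)⁻¹ * t e.2) * h) (x (r e.2)))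
    have h3 : (g v (x (r e.1))).ratDist (g (v * ((t e.1)⁻¹ * t e.2) * h) (x (r e.2))) =
        ω e.1 e.2 / D := by
      rw [hmul, hH _ h hh, hmul, hisom, ← hisom (t e.1), ht, ← hmul, mul_inv_cancel_left, ht, hω]
    have h4 : (pathWeight ω (e :: l) : ℚ) = ω e.1 e.2 + pathWeight ω l := by
      simp [pathWeight]
    rw [h4, add_div]
    linarith

end Approx

/-- The point `a` is modelled by the coset of `t a` modulo `H (r a)`, where `r a` represents its
orbit. After passing to `Γ ⧸ N`, distances between points of `B` survive because (RZ) separates `(t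
a)⁻¹ * t b` from every coset product given by a path that is too short. -/
theorem exists_finite_approximation {Γ : Type*} [Group Γ] (hΓ : HasPropertyRZ Γ)
    (π : Γ →* (QU ≃ᵢ QU)) {A : Set QU} (hA : A.Finite) {F : Set Γ} (hF : F.Finite) :
    ∃ N : Subgroup Γ, N.Normal ∧ N.FiniteIndex ∧ ∃ θ : Γ →* (QU ≃ᵢ QU), (∀ n ∈ N, θ n = 1) ∧
      (∀ γ ∈ F, ∀ a ∈ A, θ γ a = π γ a) ∧ ∃ z, ∀ γ, θ γ z = z := by
  classical
  have hp := QU.isPseudo_ratDist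
  let B : Set QU := A ∪ ⋃ γ ∈ F, π γ '' A
  have hB : B.Finite := hA.union (hF.biUnion fun γ _ => hA.image _)
  have : Finite B := hB
  have hmul : ∀ γ δ (y : QU), π (γ * δ) y = π γ (π δ y) := fun γ δ y => by
    rw [map_mul]; rfl
  have hone : ∀ y : QU, π 1 y = y := fun y => by rw [map_one]; rfl
  let orb : Setoid B :=
    { r := fun a b => ∃ γ, π γ a = b
      iseqv := ⟨fun a => ⟨1, hone a⟩,
        fun {a b} ⟨γ, h⟩ => ⟨γ⁻¹, by rw [← h, ← hmul, inv_mul_cancel, hone]⟩,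
        fun {a b c} ⟨γ, h⟩ ⟨δ, h'⟩ => ⟨δ * γ, by rw [hmul, h, h']⟩⟩ }
  let r : B → B := fun a => (Quotient.mk orb a).out
  have hr : ∀ a : B, ∃ γ, π γ (r a) = a := fun a => Quotient.exact (Quotient.out_eq (Quotient.mk orb a))
  have hr' : ∀ (a b : B) (γ : Γ), π γ a = b → r a = r b := fun a b γ h =>
    congrArg Quotient.out (Quotient.sound (s := orb) ⟨γ, h⟩)
  choose t ht using hr
  -- Stabilisers need not be finitely generated. These finitely many elements suffice to force `γ ∈
  -- F` to move `a` to `π γ a` in the coset model.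
  let gens : B → Set Γ := fun c =>
    (fun p : Γ × B × B => (t p.2.2)⁻¹ * (p.1 * t p.2.1)) '' (F ×ˢ Set.univ) ∩ {u | π u c = c}
  let H : B → Subgroup Γ := fun c => Subgroup.closure (gens c)
  have hHfg : ∀ c, (H c).FG := fun c => (Subgroup.fg_iff _).2
    ⟨gens c, rfl, ((hF.prod Set.finite_univ).image _).inter_of_left _⟩
  have hHfix : ∀ c, ∀ h ∈ H c, π h c = c := fun c h hh => by
    refine Subgroup.closure_induction (fun u hu => hu.2) (hone c) (fun u v _ _ hu hv => ?_)
      (fun u _ hu => ?_) hh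
    · rw [hmul, hv, hu]
    · conv_lhs => rw [← hu]
      rw [← hmul, inv_mul_cancel, hone]
  obtain ⟨D, ω', hD, hω'⟩ := exists_common_denominator
    (fun p : B × B => p.1.1.ratDist p.2.1) fun p => hp.nonneg _ _
  let ω : B → B → ℕ := fun a b => ω' (a, b)
  have hω : ∀ a b : B, a.1.ratDist b.1 = ω a b / D := fun a b => hω' (a, b)
  have hD' : (0 : ℚ) < D := Nat.cast_pos.2 hD
  obtain ⟨M, hM⟩ := (Set.finite_range ω').bddAbove
  have hM : ∀ a b, ω a b ≤ M := fun a b => hM ⟨(a, b), rfl⟩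
  have hlists : Finite {l : List (B × B) | l.length ≤ M} := List.finite_length_le _ M
  have hsep : ∀ j : {l : List (B × B) | l.length ≤ M} × B × B, ∃ N : Subgroup Γ,
      N.Normal ∧ N.FiniteIndex ∧ ((t j.2.1)⁻¹ * t j.2.2 ∉
        pathSet t r H ω j.1.1 (r j.2.1) (r j.2.2) → ∀ n ∈ N, (t j.2.1)⁻¹ * t j.2.2 * n ∉
        pathSet t r H ω j.1.1 (r j.2.1) (r j.2.2)) := fun j => by
    by_cases h : (t j.2.1)⁻¹ * t j.2.2 ∈ pathSet t r H ω j.1.1 (r j.2.1) (r j.2.2)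
    · exact ⟨⊤, inferInstance, inferInstance, fun h' => absurd h h'⟩
    · obtain ⟨N, h1, h2, h3⟩ := (isCosetProduct_pathSet hHfg j.1.1 _ _).exists_separating hΓ h
      exact ⟨N, h1, h2, fun _ => h3⟩
  choose N' hN1 hN2 hN3 using hsep
  let N : Subgroup Γ := ⨅ j, N' j
  have hN : N.Normal := Subgroup.normal_iInf_normal hN1
  have hN' : N.FiniteIndex := Subgroup.finiteIndex_iInf hN2
  let f : Γ →* Γ ⧸ N := QuotientGroup.mk' N
  have hdist : ∀ a b : B, pathDist t r H ω f M (f (t a), r a) (f (t b), r b) = ω a b := by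
    intro a b
    apply le_antisymm
    · rw [pathDist_le_iff]
      right
      rcases Nat.eq_zero_or_pos (ω a b) with h0 | h0
      · have : a = b := Subtype.ext (QU.eq_of_ratDist_eq_zero (by rw [hω, h0]; simp))
        subst this
        exact ⟨[], by simp [pathWeight], 1, ⟨rfl, one_mem _⟩, by simp⟩
      · refine ⟨[(a, b)], by simp [pathWeight], (t a)⁻¹ * t b,
          ⟨rfl, h0, 1, ⟨rfl, one_mem _⟩, 1, one_mem _, by simp⟩, by simp⟩
    · rcases pathDist_le_iff.1 (le_refl (pathDist t r H ω f M (f (t a), r a) (f (t b), r b)))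
        with h | ⟨l, hl, u, hu, hfu⟩
      · exact (hM a b).trans h
      refine le_trans ?_ hl
      by_contra! hlt
      have hlen : l.length ≤ M := (length_le_pathWeight hu).trans (hlt.le.trans (hM a b))
      -- A too short path in the quotient gives `u` in the coset of `(t a)⁻¹ * t b` modulo `N`. The
      -- latter is not in the path set by `le_pathWeight`, so by the choice of `N` neither is `u`.
      refine hN3 (⟨l, hlen⟩, a, b) (fun hmem => ?_) (((t a)⁻¹ * t b)⁻¹ * u) ?_ ?_
      · have h1 := le_pathWeight (g := fun γ => π γ) (x := fun b : B => (b : QU)) hD hmul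
          (fun γ => isometry_ratDist (π γ)) ht hHfix hω hmem
        have h2 := isometry_ratDist (π (t a)) (r a) (π ((t a)⁻¹ * t b) (r b))
        rw [ht, ← hmul, mul_inv_cancel_left, ht, hω] at h2
        rw [← h2, div_le_div_iff_of_pos_right hD'] at h1
        exact absurd (Nat.cast_le.1 h1) (not_le.2 hlt)
      · have : ((t a)⁻¹ * t b)⁻¹ * u ∈ N := by
          rw [← QuotientGroup.eq]
          change f _ = f u
          rw [hfu, map_mul, map_inv]
        exact Subgroup.mem_iInf.1 this _
      · rw [mul_inv_cancel_left]
        exact hu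
  let act : MulAction (Γ ⧸ N) ((Γ ⧸ N) × B) :=
    { smul := fun q y => (q * y.1, y.2)
      one_smul := fun y => Prod.ext (one_mul _) rfl
      mul_smul := fun q q' y => Prod.ext (mul_assoc _ _ _) rfl }
  obtain ⟨ψ, ρ, hψ, hψB, hact, hρ⟩ := QU.exists_equivariant_extension (Q := Γ ⧸ N)
    (pathDist_isPseudo (g := t) (r := r) (H := H) (ω := ω) (f := f) (M := M) D)
    (fun q y z => by
      have h1 := pathDist_smul (g := t) (r := r) (H := H) (ω := ω) (f := f) (M := M) q y z
      have h2 := pathDist_smul (g := t) (r := r) (H := H) (ω := ω) (f := f) (M := M) q z y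
      change (((max (pathDist t r H ω f M (q * y.1, y.2) (q * z.1, z.2))
        (pathDist t r H ω f M (q * z.1, z.2) (q * y.1, y.2)) : ℕ) : ℚ) / D) = _
      rw [h1, h2])
    (fun a : B => (f (t a), r a)) (fun a => (a : QU)) (fun a b => by
      have : ω b a = ω a b := by
        have := hp.symm a.1 b.1
        rw [hω, hω, div_left_inj' hD'.ne'] at this
        exact_mod_cast this.symm
      rw [hdist, hdist, this, max_self, hω])
  obtain ⟨θ, hθ, z, hz⟩ := hact.exists_extending_hom_fixing (Set.finite_range ψ)
  refine ⟨N, hN, hN', θ.comp f, fun n hn => ?_, fun γ hγ a ha => ?_, z, fun γ => hz _⟩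
  · have : f n = 1 := (QuotientGroup.eq_one_iff n).2 hn
    rw [MonoidHom.comp_apply, this, map_one]
  · have haB : a ∈ B := Or.inl ha
    have hbB : π γ a ∈ B := Or.inr (Set.mem_biUnion hγ ⟨a, ha, rfl⟩)
    have hra : r ⟨a, haB⟩ = r ⟨π γ a, hbB⟩ := hr' _ _ γ rfl
    have h1 := hρ (f γ) (f (t ⟨a, haB⟩), r ⟨a, haB⟩)
    rw [hψB, ← hθ _ _ ⟨_, hψB ⟨a, haB⟩⟩] at h1
    change θ (f γ) a = _ at h1
    rw [MonoidHom.comp_apply, h1]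
    change _ = ((⟨π γ a, hbB⟩ : B) : QU)
    rw [← hψB]
    apply QU.eq_of_ratDist_eq_zero
    rw [hψ]
    -- This generator of `H` puts the translate of the model of `a` by `γ` at distance zero from the
    -- model of `π γ a`, in both directions.
    have hmem : (t ⟨π γ a, hbB⟩)⁻¹ * (γ * t ⟨a, haB⟩) ∈ H (r ⟨a, haB⟩) := by
      refine Subgroup.subset_closure ⟨⟨(γ, ⟨a, haB⟩, ⟨π γ a, hbB⟩), ⟨hγ, trivial⟩, rfl⟩, ?_⟩
      change π _ _ = _
      rw [hmul, hmul, ht]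
      change π (t ⟨π γ a, hbB⟩)⁻¹ ((⟨π γ a, hbB⟩ : B) : QU) = _
      conv_lhs => rw [← ht ⟨π γ a, hbB⟩]
      rw [← hmul, inv_mul_cancel, hone, hra]
    have h2 := pathDist_eq_zero (g := t) (r := r) (H := H) (ω := ω) (f := f) (M := M)
      (q := f (t ⟨π γ a, hbB⟩)) hmem
    have h3 := pathDist_eq_zero (g := t) (r := r) (H := H) (ω := ω) (f := f) (M := M)
      (q := f γ * f (t ⟨a, haB⟩)) (inv_mem hmem)
    have e1 : f (t ⟨π γ a, hbB⟩) * f ((t ⟨π γ a, hbB⟩)⁻¹ * (γ * t ⟨a, haB⟩)) =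
        f γ * f (t ⟨a, haB⟩) := by
      simp only [← map_mul]
      congr 1
      group
    have e2 : f γ * f (t ⟨a, haB⟩) * f ((t ⟨π γ a, hbB⟩)⁻¹ * (γ * t ⟨a, haB⟩))⁻¹ =
        f (t ⟨π γ a, hbB⟩) := by
      simp only [← map_mul]
      congr 1
      group
    rw [e1] at h2
    rw [e2] at h3
    change (((max (pathDist t r H ω f M (f γ * f (t ⟨a, haB⟩), r ⟨a, haB⟩)
        (f (t ⟨π γ a, hbB⟩), r ⟨π γ a, hbB⟩)) (pathDist t r H ω f M
        (f (t ⟨π γ a, hbB⟩), r ⟨π γ a, hbB⟩) (f γ * f (t ⟨a, haB⟩), r ⟨a, haB⟩)) : ℕ) : ℚ) / D) = 0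
    rw [← hra, h2, h3]
    simp

/-! ### The topology on the space of representations -/

section RepTopology

variable {Γ : Type*} [Group Γ]

theorem QU.idx_injective : Function.Injective QU.idx := fun x y h => by
  cases x; cases y; cases h; rfl

theorem permutationGroupTopology_eq : permutationGroupTopology QU =
    ⨅ n : ℕ, TopologicalSpace.induced (fun g : QU ≃ᵢ QU => (g ⟨n⟩).idx) ⊥ := by
  apply le_antisymm
  · refine le_iInf fun n => ?_
    rw [← continuous_iff_le_induced, @continuous_discrete_rng _ _ _ ⊥ ⟨rfl⟩]
    intro k
    by_cases h : ∃ f : QU ≃ᵢ QU, (f ⟨n⟩).idx = k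
    · obtain ⟨f, rfl⟩ := h
      refine TopologicalSpace.isOpen_generateFrom_of_mem ⟨f, {⟨n⟩}, ?_⟩
      ext g
      simp [QU.idx_injective.eq_iff]
    · convert @isOpen_empty _ (permutationGroupTopology QU) using 1
      exact Set.eq_empty_of_forall_notMem fun g hg => h ⟨g, hg⟩
  · refine le_generateFrom ?_
    rintro _ ⟨f, A, rfl⟩
    have : {g : QU ≃ᵢ QU | ∀ x ∈ A, g x = f x} = ⋂ x ∈ A, {g : QU ≃ᵢ QU | g x = f x} := by
      ext; simp
    rw [this]
    refine @isOpen_biInter_finset _ _ (_) _ _ fun x _ => ?_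
    refine TopologicalSpace.le_def.1 (iInf_le _ x.idx) _ ?_
    exact ⟨{(f x).idx}, trivial, by ext g; simp [QU.idx_injective.eq_iff]⟩

/-- A representation as a table of natural numbers. -/
noncomputable def repCode (π : Γ →* (QU ≃ᵢ QU)) (p : Γ × ℕ) : ℕ := (π p.1 ⟨p.2⟩).idx

theorem isInducing_repCode : Topology.IsInducing (repCode (Γ := Γ)) where
  eq_induced := by
    have h : (inferInstance : TopologicalSpace ℕ) = ⊥ := DiscreteTopology.eq_bot
    change TopologicalSpace.induced _ (⨅ γ, TopologicalSpace.induced _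
      (permutationGroupTopology QU)) = TopologicalSpace.induced _ (⨅ p, TopologicalSpace.induced _ _)
    rw [permutationGroupTopology_eq]
    simp only [induced_iInf, induced_compose, iInf_prod]
    rfl

theorem exists_rep_of_code {h : Γ × ℕ → ℕ} (h1 : ∀ n, h (1, n) = n)
    (hmul : ∀ γ δ n, h (γ * δ, n) = h (γ, h (δ, n)))
    (hisom : ∀ γ m n, (⟨h (γ, m)⟩ : QU).ratDist ⟨h (γ, n)⟩ = (⟨m⟩ : QU).ratDist ⟨n⟩) :
    ∃ π : Γ →* (QU ≃ᵢ QU), repCode π = h := by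
  have hact : IsActOn (fun (γ : Γ) (x : QU) => (⟨h (γ, x.idx)⟩ : QU)) Set.univ :=
    ⟨fun _ _ _ => trivial, fun x _ => QU.idx_injective (h1 _),
      fun _ _ x _ => QU.idx_injective (hmul _ _ _), fun γ x _ y _ => hisom γ x.idx y.idx⟩
  obtain ⟨π, hπ⟩ := hact.exists_hom
  exact ⟨π, funext fun p => congrArg QU.idx (hπ p.1 ⟨p.2⟩)⟩

theorem isClosedEmbedding_repCode : Topology.IsClosedEmbedding (repCode (Γ := Γ)) where
  toIsInducing := isInducing_repCode
  injective π θ h := MonoidHom.ext fun γ => IsometryEquiv.ext fun x =>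
    QU.idx_injective (congrFun h (γ, x.idx))
  isClosed_range := by
    -- Multiplicativity evaluates `h` at a coordinate depending on `h`; quantifying over its value
    -- `k` makes each condition closed.
    have : Set.range (repCode (Γ := Γ)) = (⋂ n, {h | h (1, n) = n}) ∩
        (⋂ γ, ⋂ δ, ⋂ n, ⋂ k, {h | h (δ, n) = k → h (γ * δ, n) = h (γ, k)}) ∩
        ⋂ γ, ⋂ m, ⋂ n, {h | (⟨h (γ, m)⟩ : QU).ratDist ⟨h (γ, n)⟩ = (⟨m⟩ : QU).ratDist ⟨n⟩} := by
      ext h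
      simp only [Set.mem_range, Set.mem_inter_iff, Set.mem_iInter, Set.mem_ofPred_eq]
      constructor
      · rintro ⟨π, rfl⟩
        refine ⟨⟨fun n => ?_, fun γ δ n k hk => ?_⟩, fun γ m n => isometry_ratDist (π γ) _ _⟩
        · simp [repCode]
        · subst hk
          simp [repCode]
      · rintro ⟨⟨h1, h2⟩, h3⟩
        exact exists_rep_of_code h1 (fun γ δ n => h2 γ δ n _ rfl) h3
    rw [this]
    have hc : ∀ p : Γ × ℕ, Continuous fun h : Γ × ℕ → ℕ => h p := continuous_apply
    refine (IsClosed.inter ?_ ?_).inter ?_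
    · exact isClosed_iInter fun n => isClosed_eq (hc _) continuous_const
    · refine isClosed_iInter fun γ => isClosed_iInter fun δ => isClosed_iInter fun n =>
        isClosed_iInter fun k => isClosed_imp ?_ (isClosed_eq (hc _) (hc _))
      exact (isOpen_discrete {k}).preimage (hc _)
    · refine isClosed_iInter fun γ => isClosed_iInter fun m => isClosed_iInter fun n => ?_
      exact (isClosed_discrete {p : ℕ × ℕ | (⟨p.1⟩ : QU).ratDist ⟨p.2⟩ =
        (⟨m⟩ : QU).ratDist ⟨n⟩}).preimage ((hc (γ, m)).prodMk (hc (γ, n)))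

theorem polishSpace_rep [Countable Γ] : PolishSpace (Γ →* (QU ≃ᵢ QU)) :=
  isClosedEmbedding_repCode.polishSpace

theorem isOpen_agree (π : Γ →* (QU ≃ᵢ QU)) {F : Set Γ} (hF : F.Finite) {B : Set QU}
    (hB : B.Finite) : IsOpen {θ : Γ →* (QU ≃ᵢ QU) | ∀ γ ∈ F, ∀ x ∈ B, θ γ x = π γ x} := by
  have : {θ : Γ →* (QU ≃ᵢ QU) | ∀ γ ∈ F, ∀ x ∈ B, θ γ x = π γ x} =
      ⋂ γ ∈ F, ⋂ x ∈ B, {θ | repCode θ (γ, x.idx) = repCode π (γ, x.idx)} := by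
    ext θ
    simp [repCode, QU.idx_injective.eq_iff]
  rw [this]
  refine hF.isOpen_biInter fun γ _ => hB.isOpen_biInter fun x _ => ?_
  exact (isOpen_discrete {repCode π (γ, x.idx)}).preimage
    ((continuous_apply _).comp isInducing_repCode.continuous)

theorem exists_agree_subset {U : Set (Γ →* (QU ≃ᵢ QU))} (hU : IsOpen U) {π : Γ →* (QU ≃ᵢ QU)}
    (hπ : π ∈ U) : ∃ (F : Set Γ) (B : Set QU), F.Finite ∧ B.Finite ∧
      ∀ θ : Γ →* (QU ≃ᵢ QU), (∀ γ ∈ F, ∀ x ∈ B, θ γ x = π γ x) → θ ∈ U := by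
  classical
  obtain ⟨V, hV, rfl⟩ := isInducing_repCode.isOpen_iff.1 hU
  obtain ⟨I, u, hu, hI⟩ := isOpen_pi_iff.1 hV _ hπ
  refine ⟨Prod.fst '' (I : Set (Γ × ℕ)), (fun p : Γ × ℕ => (⟨p.2⟩ : QU)) '' (I : Set (Γ × ℕ)),
    I.finite_toSet.image _, I.finite_toSet.image _, fun θ hθ => hI fun p hp => ?_⟩
  have : repCode θ p = repCode π p :=
    congrArg QU.idx (hθ p.1 ⟨p, hp, rfl⟩ ⟨p.2⟩ ⟨p, hp, rfl⟩)
  rw [this]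
  exact (hu p hp).2

/-- Openness criterion: membership depends on the values of finitely many group elements at
finitely many points. -/
theorem isOpen_of_agree {U : Set (Γ →* (QU ≃ᵢ QU))}
    (h : ∀ π ∈ U, ∃ (F : Set Γ) (B : Set QU), F.Finite ∧ B.Finite ∧
      ∀ θ : Γ →* (QU ≃ᵢ QU), (∀ γ ∈ F, ∀ x ∈ B, θ γ x = π γ x) → θ ∈ U) : IsOpen U :=
  isOpen_iff_forall_mem_open.2 fun π hπ => by
    obtain ⟨F, B, hF, hB, hU⟩ := h π hπ
    exact ⟨_, hU, isOpen_agree π hF hB, fun _ _ _ _ => rfl⟩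

end RepTopology

theorem Group.FG.countable' {Γ : Type*} [Group Γ] [h : Group.FG Γ] : Countable Γ := by
  obtain ⟨S, hS, hfin⟩ := Group.fg_iff.1 h
  have := hfin.countable.to_subtype
  have hsurj : Function.Surjective (FreeGroup.lift (fun s : S => (s : Γ))) := by
    rw [← MonoidHom.range_eq_top, FreeGroup.range_lift_eq_closure, Subtype.range_coe, hS]
  have : Countable (FreeGroup S) := Quot.mk_surjective.countable
  exact hsurj.countable

/-! ### Finite invariant sets -/

section Invariant

variable {Γ Λ : Type*} [Group Γ] [Group Λ]

theorem IsActOn.of_hom (π : Γ →* (QU ≃ᵢ QU)) {T : Set QU} (hT : ∀ γ, ∀ x ∈ T, π γ x ∈ T) :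
    IsActOn (fun γ x => π γ x) T :=
  ⟨hT, fun x _ => by simp, fun γ δ x _ => by simp, fun γ x _ y _ => isometry_ratDist _ _ _⟩

theorem exists_finiteIndex_fixing (π : Γ →* (QU ≃ᵢ QU)) {T : Set QU} (hT : T.Finite)
    (hinv : ∀ γ, ∀ x ∈ T, π γ x ∈ T) :
    ∃ N : Subgroup Γ, N.Normal ∧ N.FiniteIndex ∧ ∀ n ∈ N, ∀ x ∈ T, π n x = x := by
  let := (IsActOn.of_hom π hinv).mulAction
  have : Finite T := hT
  refine ⟨(MulAction.toPermHom Γ T).ker, inferInstance, inferInstance, fun n hn x hx => ?_⟩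
  exact congrArg Subtype.val (Equiv.congr_fun ((MonoidHom.mem_ker).1 hn) ⟨x, hx⟩)

theorem finite_orbit (π : Γ →* (QU ≃ᵢ QU)) {N : Subgroup Γ} (hN : N.FiniteIndex) {x : QU}
    (hx : ∀ n ∈ N, π n x = x) : (Set.range fun γ => π γ x).Finite := by
  refine (Set.finite_range fun q : Γ ⧸ N => π q.out x).subset ?_
  rintro _ ⟨γ, rfl⟩
  obtain ⟨n, hn⟩ := QuotientGroup.mk_out_eq_mul N γ
  refine ⟨(γ : Γ ⧸ N), ?_⟩
  simp [hn, hx n n.2]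

theorem exists_finite_invariant (π : Γ →* (QU ≃ᵢ QU)) {B : Set QU} (hB : B.Finite)
    (h : ∀ x ∈ B, (Set.range fun γ => π γ x).Finite) :
    ∃ A : Set QU, A.Finite ∧ B ⊆ A ∧ ∀ γ, ∀ x ∈ A, π γ x ∈ A := by
  refine ⟨⋃ x ∈ B, Set.range fun γ => π γ x, hB.biUnion h, fun x hx => ?_, ?_⟩
  · exact Set.mem_biUnion hx ⟨1, by simp⟩
  · intro γ y hy
    simp only [Set.mem_iUnion, Set.mem_range] at hy ⊢
    obtain ⟨x, hx, δ, rfl⟩ := hy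
    exact ⟨x, hx, γ * δ, by simp⟩

theorem exists_monoid_generators [h : Group.FG Γ] :
    ∃ S : Set Γ, S.Finite ∧ Submonoid.closure S = ⊤ := by
  obtain ⟨S, hS, hfin⟩ := Monoid.fg_iff.1 (Group.fg_iff_monoid_fg.1 h)
  exact ⟨S, hfin, hS⟩

/-- On an invariant set the generators determine the whole action. This turns conditions on all
group elements into open ones; monoid generators avoid inverses. -/
theorem agree_of_generators {S : Set Γ} (hS : Submonoid.closure S = ⊤)
    {π θ : Γ →* (QU ≃ᵢ QU)} {B : Set QU} (hB : ∀ γ, ∀ x ∈ B, π γ x ∈ B)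
    (h : ∀ s ∈ S, ∀ x ∈ B, θ s x = π s x) (γ : Γ) : ∀ x ∈ B, θ γ x = π γ x := by
  have hγ : γ ∈ Submonoid.closure S := hS ▸ Submonoid.mem_top γ
  induction hγ using Submonoid.closure_induction with
  | mem s hs => exact h s hs
  | one => exact fun x _ => by simp
  | mul γ δ _ _ h1 h2 =>
    intro x hx
    simp only [map_mul, IsometryEquiv.mul_apply]
    rw [h2 x hx, h1 _ (hB δ x hx)]

/-- Amalgamation of a finite part `A` of a representation of `Γ` with a finite part `T` of a
representation of `Λ`. -/
theorem exists_amalgamating_rep (ι : Λ →* Γ) (N : Subgroup Γ) [hN : N.Normal] [N.FiniteIndex]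
    (π : Γ →* (QU ≃ᵢ QU)) (θ : Λ →* (QU ≃ᵢ QU)) {A T : Set QU} (hA : A.Finite) (hT : T.Finite)
    (hAinv : ∀ γ, ∀ a ∈ A, π γ a ∈ A) (hTinv : ∀ l, ∀ t ∈ T, θ l t ∈ T)
    (hNA : ∀ n ∈ N, ∀ a ∈ A, π n a = a) (hNT : ∀ l, ι l ∈ N → ∀ t ∈ T, θ l t = t)
    {c : Set (QU × QU)} (hc : c.Nonempty) (hcT : ∀ p ∈ c, p.1 ∈ T) (hcA : ∀ p ∈ c, p.2 ∈ A)
    (hciso : ∀ p ∈ c, ∀ q ∈ c, p.1.ratDist q.1 = p.2.ratDist q.2)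
    (hcinv : ∀ l, ∀ p ∈ c, (θ l p.1, π (ι l) p.2) ∈ c) :
    ∃ π' : Γ →* (QU ≃ᵢ QU), (∀ n ∈ N, π' n = 1) ∧ (∀ γ, ∀ a ∈ A, π' γ a = π γ a) ∧
      ∃ f : QU → QU, (∀ t ∈ T, ∀ u ∈ T, (f t).ratDist (f u) = t.ratDist u) ∧
        (∀ p ∈ c, f p.1 = p.2) ∧ ∀ l, ∀ t ∈ T, f (θ l t) = π' (ι l) (f t) := by
  classical
  have hp := QU.isPseudo_ratDist
  have hpS : ∀ U : Set QU, IsPseudo fun a b : U => a.1.ratDist b.1 := fun U =>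
    ⟨fun _ => hp.refl _, fun _ _ => hp.symm _ _, fun _ _ _ => hp.tri _ _ _⟩
  -- As `N` fixes `A` pointwise, coset representatives define an action of the finite group `Γ ⧸ N`
  -- on `A`.
  have hout : ∀ γ : Γ, ∀ a ∈ A, π (QuotientGroup.mk (s := N) γ).out a = π γ a := fun γ a ha => by
    obtain ⟨n, hn⟩ := QuotientGroup.mk_out_eq_mul N γ
    rw [hn, map_mul, IsometryEquiv.mul_apply, hNA n n.2 a ha]
  have hmk : ∀ q : Γ ⧸ N, ((q.out : Γ) : Γ ⧸ N) = q := fun q => Quotient.out_eq' q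
  have hAact : IsActOn (fun (q : Γ ⧸ N) x => π q.out x) A := by
    refine ⟨fun q x hx => hAinv _ x hx, fun x hx => ?_, fun q q' x hx => ?_,
      fun q x _ y _ => isometry_ratDist _ _ _⟩
    · have := hout 1 x hx
      simpa using this
    · have := hout (q.out * q'.out) x hx
      rw [QuotientGroup.mk_mul, hmk, hmk] at this
      simpa using this
  let := hAact.mulAction
  let := (IsActOn.of_hom θ hTinv).mulAction
  have : Finite A := hA
  have : Finite T := hT
  have : Finite c := (hT.prod hA).subset fun p hp => ⟨hcT p hp, hcA p hp⟩
  have : Nonempty c := hc.to_subtype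
  have : Nonempty A := hc.elim fun p hp => ⟨⟨p.2, hcA p hp⟩⟩
  obtain ⟨Y, _, _, d, eA, eT, hd, hQ, hdA, hdT, hsmul, hsmulT, hglue⟩ :=
    exists_equivariant_amalgam (S := c) (A := A) (T := T) ((QuotientGroup.mk' N).comp ι)
    (dA := fun a b => a.1.ratDist b.1) (dT := fun a b => a.1.ratDist b.1)
    (fun p => ⟨p.1.2, hcA p p.2⟩) (fun p => ⟨p.1.1, hcT p p.2⟩)
    (fun l hl t => Subtype.ext (hNT l ((QuotientGroup.eq_one_iff _).1 hl) t t.2))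
    (hpS _) (hpS _) (fun q a b => isometry_ratDist _ _ _) (fun l t u => isometry_ratDist _ _ _)
    (fun p q => (hciso p p.2 q q.2).symm)
    (fun l p => ⟨⟨_, hcinv l p p.2⟩, Subtype.ext (hout (ι l) _ (hcA p p.2)).symm, rfl⟩)
  obtain ⟨ψ, ρ, hψ, hψA, hact, hρ⟩ := QU.exists_equivariant_extension hd hQ eA
    (fun t => (t : QU)) fun a b => (hdA a b).symm
  obtain ⟨σ, hσ, -⟩ := hact.exists_extending_hom_fixing (Set.finite_range ψ)
  have hσψ : ∀ q y, σ q (ψ y) = ψ (q • y) := fun q y => by rw [hσ q _ ⟨y, rfl⟩, hρ]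
  have hzero : ∀ y z, d y z = 0 → ψ y = ψ z := fun y z h =>
    QU.eq_of_ratDist_eq_zero (by rw [hψ, h])
  let f : QU → QU := fun t => if h : t ∈ T then ψ (eT ⟨t, h⟩) else t
  have hf : ∀ t (h : t ∈ T), f t = ψ (eT ⟨t, h⟩) := fun t h => dif_pos h
  refine ⟨σ.comp (QuotientGroup.mk' N), fun n hn => ?_, fun γ a ha => ?_, f,
    fun t ht u hu => ?_, fun p hp => ?_, fun l t ht => ?_⟩
  · have : QuotientGroup.mk' N n = 1 := (QuotientGroup.eq_one_iff n).2 hn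
    rw [MonoidHom.comp_apply, this, map_one]
  · have := hσψ (QuotientGroup.mk' N γ) (eA ⟨a, ha⟩)
    rw [hψA, ← hsmul, hψA] at this
    exact this.trans (hout γ a ha)
  · rw [hf t ht, hf u hu, hψ, hdT]
  · rw [hf _ (hcT p hp), hzero _ _ (hglue ⟨p, hp⟩), hψA]
  · rw [hf t ht, hf _ (hTinv l t ht)]
    exact (hzero _ _ (hsmulT l ⟨t, ht⟩)).symm.trans (hσψ _ _).symm

end Invariant

/-! ### Rich representations -/

section Rich

variable {Γ : Type*} [Group Γ]

/-- A finite nonempty partial isometry which is equivariant for `π` and `θ`, as a set of pairs. -/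
structure IsPartialIso (π θ : Γ →* (QU ≃ᵢ QU)) (c : Set (QU × QU)) : Prop where
  finite : c.Finite
  nonempty : c.Nonempty
  isom : ∀ p ∈ c, ∀ q ∈ c, p.1.ratDist q.1 = p.2.ratDist q.2
  equivariant : ∀ γ, ∀ p ∈ c, (π γ p.1, θ γ p.2) ∈ c

theorem IsPartialIso.swap {π θ : Γ →* (QU ≃ᵢ QU)} {c : Set (QU × QU)} (h : IsPartialIso π θ c) :
    IsPartialIso θ π (Prod.swap '' c) := by
  refine ⟨h.finite.image _, h.nonempty.image _, ?_, ?_⟩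
  · rintro _ ⟨p, hp, rfl⟩ _ ⟨q, hq, rfl⟩
    exact (h.isom p hp q hq).symm
  · rintro γ _ ⟨p, hp, rfl⟩
    exact ⟨_, h.equivariant γ p hp, rfl⟩

theorem IsPartialIso.congr {π π' θ θ' : Γ →* (QU ≃ᵢ QU)} {c : Set (QU × QU)}
    (h : IsPartialIso π θ c) (h1 : ∀ γ, ∀ p ∈ c, π' γ p.1 = π γ p.1)
    (h2 : ∀ γ, ∀ p ∈ c, θ' γ p.2 = θ γ p.2) : IsPartialIso π' θ' c :=
  ⟨h.finite, h.nonempty, h.isom, fun γ p hp => by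
    rw [h1 γ p hp, h2 γ p hp]; exact h.equivariant γ p hp⟩

/-- The partial isometry `c` extends to an equivariant isometry with domain `T`. -/
def ExtendsTo (π θ : Γ →* (QU ≃ᵢ QU)) (c : Set (QU × QU)) (T : Set QU) : Prop :=
  IsPartialIso π θ c → ∃ c', c ⊆ c' ∧ IsPartialIso π θ c' ∧ Prod.fst '' c' = T

/-- Representations with finite orbits which realise all finite extensions. -/
structure IsRich (θ : Γ →* (QU ≃ᵢ QU)) : Prop where
  orbit_finite : ∀ x, (Set.range fun γ => θ γ x).Finite
  exists_fixed : ∃ z, ∀ γ, θ γ z = z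
  extends_to : ∀ (π : Γ →* (QU ≃ᵢ QU)) (c : Set (QU × QU)) (T : Set QU), T.Finite →
    (∀ γ, ∀ x ∈ T, π γ x ∈ T) → (∀ p ∈ c, p.1 ∈ T) → ExtendsTo π θ c T

/-- Finite orbits of `π` place `x` and the domain of `c` in a finite invariant set, to which
richness of `θ` applies. -/
theorem IsRich.exists_extension {π θ : Γ →* (QU ≃ᵢ QU)} (hπ : IsRich π) (hθ : IsRich θ)
    {c : Set (QU × QU)} (hc : IsPartialIso π θ c) (x : QU) :
    ∃ c', c ⊆ c' ∧ IsPartialIso π θ c' ∧ ∃ y, (x, y) ∈ c' := by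
  obtain ⟨T, hT, hsub, hinv⟩ := exists_finite_invariant π
    ((hc.finite.image Prod.fst).insert x) fun y _ => hπ.orbit_finite y
  obtain ⟨c', h1, h2, h3⟩ := hθ.extends_to π c T hT hinv
    (fun p hp => hsub (Set.mem_insert_of_mem _ ⟨p, hp, rfl⟩)) hc
  have hx : x ∈ Prod.fst '' c' := h3 ▸ hsub (Set.mem_insert _ _)
  obtain ⟨⟨_, y⟩, hp, rfl⟩ := hx
  exact ⟨c', h1, h2, y, hp⟩

/-- Any two rich representations are conjugate. -/
theorem IsRich.mem_conjOrbit {π θ : Γ →* (QU ≃ᵢ QU)} (hπ : IsRich π) (hθ : IsRich θ) :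
    θ ∈ conjOrbit π := by
  have hp := QU.isPseudo_ratDist
  obtain ⟨x₀, hx₀⟩ := hπ.exists_fixed
  obtain ⟨y₀, hy₀⟩ := hθ.exists_fixed
  have h₀ : IsPartialIso π θ {(x₀, y₀)} := by
    refine ⟨Set.finite_singleton _, Set.singleton_nonempty _, ?_, ?_⟩
    · rintro _ rfl _ rfl
      rw [hp.refl, hp.refl]
    · rintro γ _ rfl
      rw [hx₀, hy₀]
      rfl
  obtain ⟨f, hf, -, hD⟩ := exists_monotone_seq (P := {c // IsPartialIso π θ c}) ⟨_, h₀⟩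
    (D := fun n c => (∃ y, ((⟨n⟩ : QU), y) ∈ c.1) ∧ ∃ x, (x, (⟨n⟩ : QU)) ∈ c.1) (by
      rintro n ⟨c, hc⟩
      obtain ⟨c₁, h1, h2, y, hy⟩ := hπ.exists_extension hθ hc ⟨n⟩
      obtain ⟨c₂, h3, h4, x, hx⟩ := hθ.exists_extension hπ h2.swap ⟨n⟩
      have h5 : c₁ ⊆ Prod.swap '' c₂ := fun p hp => ⟨p.swap, h3 ⟨p, hp, rfl⟩, p.swap_swap⟩
      exact ⟨⟨_, h4.swap⟩, h1.trans h5, ⟨y, h5 hy⟩, x, _, hx, rfl⟩)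
  have hdir : ∀ p q : QU × QU, (∃ n, p ∈ (f n).1) → (∃ n, q ∈ (f n).1) →
      p.1.ratDist q.1 = p.2.ratDist q.2 := by
    rintro p q ⟨n, hpn⟩ ⟨m, hqm⟩
    exact (f (max n m)).2.isom p (hf (le_max_left n m) hpn) q (hf (le_max_right n m) hqm)
  have h1 : ∀ x : QU, ∃ y, ∃ n, (x, y) ∈ (f n).1 := fun x => by
    obtain ⟨⟨y, hy⟩, -⟩ := hD x.idx
    exact ⟨y, _, hy⟩
  have h2 : ∀ y : QU, ∃ x, ∃ n, (x, y) ∈ (f n).1 := fun y => by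
    obtain ⟨-, x, hx⟩ := hD y.idx
    exact ⟨x, _, hx⟩
  choose a ha using h1
  choose b hb using h2
  have hab : ∀ x y, (∃ n, (x, y) ∈ (f n).1) → a x = y := fun x y h =>
    QU.eq_of_ratDist_eq_zero (by rw [← hdir (x, a x) (x, y) (ha x) h, hp.refl])
  let e : QU ≃ᵢ QU := IsometryEquiv.mk' a b (fun y => hab _ _ (hb y))
    (isometry_of_ratDist fun x y => (hdir (x, a x) (y, a y) (ha x) (ha y)).symm)
  refine ⟨e, fun γ => ?_⟩
  rw [mul_inv_eq_iff_eq_mul]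
  ext x
  obtain ⟨n, hn⟩ := ha x
  exact hab _ _ ⟨n, (f n).2.equivariant γ _ hn⟩

end Rich

/-! ### Rich representations are generic -/

section Comeagre

variable {Γ : Type*} [Group Γ]

theorem orbit_finite_mem_residual [Group.FG Γ] (hΓ : HasPropertyRZ Γ) (x : QU) :
    {θ : Γ →* (QU ≃ᵢ QU) | (Set.range fun γ => θ γ x).Finite} ∈ residual _ := by
  obtain ⟨S, hS, hS'⟩ := exists_monoid_generators (Γ := Γ)
  refine residual_of_dense_open (isOpen_of_agree fun θ hθ => ?_)
    (dense_iff_inter_open.2 fun U hU ⟨θ, hθ⟩ => ?_)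
  · refine ⟨S, _, hS, hθ, fun θ' h => ?_⟩
    have := agree_of_generators hS' (B := Set.range fun γ => θ γ x) (by
      rintro γ _ ⟨δ, rfl⟩
      exact ⟨γ * δ, by simp⟩) h
    refine Set.Finite.subset hθ ?_
    rintro _ ⟨γ, rfl⟩
    exact ⟨γ, (this γ x ⟨1, by simp⟩).symm⟩
  · obtain ⟨F, B, hF, hB, hFB⟩ := exists_agree_subset hU hθ
    obtain ⟨N, _, hN, θ', h1, h2, -⟩ := exists_finite_approximation hΓ θ hB hF
    exact ⟨θ', hFB θ' h2, finite_orbit θ' hN fun n hn => by rw [h1 n hn]; rfl⟩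

theorem exists_fixed_mem_residual [Group.FG Γ] (hΓ : HasPropertyRZ Γ) :
    {θ : Γ →* (QU ≃ᵢ QU) | ∃ z, ∀ γ, θ γ z = z} ∈ residual _ := by
  obtain ⟨S, hS, hS'⟩ := exists_monoid_generators (Γ := Γ)
  refine residual_of_dense_open (isOpen_of_agree fun θ hθ => ?_)
    (dense_iff_inter_open.2 fun U hU ⟨θ, hθ⟩ => ?_)
  · obtain ⟨z, hz⟩ := hθ
    refine ⟨S, {z}, hS, Set.finite_singleton z, fun θ' h => ⟨z, fun γ => ?_⟩⟩
    have := agree_of_generators hS' (B := {z}) (by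
      rintro γ _ rfl
      exact hz γ) h
    rw [this γ z rfl, hz]
  · obtain ⟨F, B, hF, hB, hFB⟩ := exists_agree_subset hU hθ
    obtain ⟨N, _, hN, θ', h1, h2, h3⟩ := exists_finite_approximation hΓ θ hB hF
    exact ⟨θ', hFB θ' h2, h3⟩

/-- An extension involves `θ` only on a finite invariant set, hence persists under agreement on
generators there. The failure of `c` to be a partial isometry persists likewise, making the
condition vacuous. -/
theorem isOpen_extendsTo [Group.FG Γ] (π : Γ →* (QU ≃ᵢ QU)) (c : Set (QU × QU)) (T : Set QU) :
    IsOpen {θ | ExtendsTo π θ c T} := by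
  obtain ⟨S, hS, hS'⟩ := exists_monoid_generators (Γ := Γ)
  have hagree : ∀ {θ θ' : Γ →* (QU ≃ᵢ QU)} {c' : Set (QU × QU)}, IsPartialIso π θ c' →
      (∀ γ ∈ S, ∀ x ∈ Prod.snd '' c', θ' γ x = θ γ x) → IsPartialIso π θ' c' := by
    intro θ θ' c' h h'
    have := agree_of_generators hS' (B := Prod.snd '' c') (by
      rintro γ _ ⟨p, hp, rfl⟩
      exact ⟨_, h.equivariant γ p hp, rfl⟩) h'
    exact h.congr (fun _ _ _ => rfl) fun γ p hp => this γ _ ⟨p, hp, rfl⟩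
  refine isOpen_of_agree fun θ hθ => ?_
  by_cases h : IsPartialIso π θ c
  · obtain ⟨c', h1, h2, h3⟩ := hθ h
    exact ⟨S, Prod.snd '' c', hS, h2.finite.image _, fun θ' h' _ => ⟨c', h1, hagree h2 h', h3⟩⟩
  · by_cases hc : c.Finite
    · exact ⟨S, Prod.snd '' c, hS, hc.image _, fun θ' h' hθ' => absurd
        (hagree hθ' fun γ hγ x hx => (h' γ hγ x hx).symm) h⟩
    · exact ⟨∅, ∅, Set.finite_empty, Set.finite_empty, fun θ' _ hθ' => absurd hθ'.finite hc⟩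

/-- After approximation by a finite quotient, the image of `c` and the points to be preserved lie in
a finite invariant `A`. Amalgamating `A` with `T` over `c` realises the extension without changing
the action on `A`. -/
theorem dense_extendsTo (hΓ : HasPropertyRZ Γ) (π : Γ →* (QU ≃ᵢ QU)) {c : Set (QU × QU)}
    {T : Set QU} (hT : T.Finite) (hinv : ∀ γ, ∀ x ∈ T, π γ x ∈ T) (hcT : ∀ p ∈ c, p.1 ∈ T) :
    Dense {θ | ExtendsTo π θ c T} := by
  refine dense_iff_inter_open.2 fun U hU ⟨θ₀, hθ₀⟩ => ?_
  obtain ⟨F, B, hF, hB, hFB⟩ := exists_agree_subset hU hθ₀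
  obtain ⟨N₁, hN₁, hN₁', θ, h1, h2, -⟩ := exists_finite_approximation hΓ θ₀ hB hF
  by_cases hc : IsPartialIso π θ c
  swap
  · exact ⟨θ, hFB θ h2, fun h => absurd h hc⟩
  have hfix : ∀ n ∈ N₁, ∀ x, θ n x = x := fun n hn x => by rw [h1 n hn]; rfl
  obtain ⟨A, hA, hsub, hAinv⟩ := exists_finite_invariant θ (hB.union (hc.finite.image Prod.snd))
    fun x _ => finite_orbit θ hN₁' fun n hn => hfix n hn x
  obtain ⟨N₂, hN₂, hN₂', h3⟩ := exists_finiteIndex_fixing π hT hinv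
  obtain ⟨θ', -, h4, f, h5, h6, h7⟩ := exists_amalgamating_rep (MonoidHom.id Γ) (N₁ ⊓ N₂) θ π hA hT
    hAinv hinv (fun n hn a _ => hfix n hn.1 a) (fun n hn => h3 n hn.2) hc.nonempty hcT
    (fun p hp => hsub (Or.inr ⟨p, hp, rfl⟩)) hc.isom hc.equivariant
  refine ⟨θ', hFB θ' fun γ hγ x hx => ?_, fun _ => ⟨(fun t => (t, f t)) '' T, fun p hp => ?_,
    ⟨hT.image _, ?_, ?_, ?_⟩, ?_⟩⟩
  · rw [h4 γ x (hsub (Or.inl hx)), h2 γ hγ x hx]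
  · exact ⟨p.1, hcT p hp, Prod.ext rfl (h6 p hp)⟩
  · obtain ⟨p, hp⟩ := hc.nonempty
    exact ⟨_, p.1, hcT p hp, rfl⟩
  · rintro _ ⟨t, ht, rfl⟩ _ ⟨u, hu, rfl⟩
    exact (h5 t ht u hu).symm
  · rintro γ _ ⟨t, ht, rfl⟩
    exact ⟨_, hinv γ t ht, Prod.ext rfl (h7 γ t ht)⟩
  · simp [Set.image_image]

theorem isRich_mem_residual [Group.FG Γ] (hΓ : HasPropertyRZ Γ) :
    {θ : Γ →* (QU ≃ᵢ QU) | IsRich θ} ∈ residual _ := by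
  obtain ⟨S, hS, hS'⟩ := exists_monoid_generators (Γ := Γ)
  have := Group.FG.countable' (Γ := Γ)
  have := polishSpace_rep (Γ := Γ)
  obtain ⟨E, hE, hE'⟩ := TopologicalSpace.exists_countable_dense (Γ →* (QU ≃ᵢ QU))
  have := hE.to_subtype
  have h1 : ∀ᶠ θ : Γ →* (QU ≃ᵢ QU) in residual _, ∀ x, (Set.range fun γ => θ γ x).Finite :=
    eventually_countable_forall.2 fun x => orbit_finite_mem_residual hΓ x
  have h2 : ∀ᶠ θ : Γ →* (QU ≃ᵢ QU) in residual _, ∀ k : E × Finset (QU × QU) × Finset QU,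
      (∀ γ, ∀ x ∈ k.2.2, k.1.1 γ x ∈ k.2.2) → (∀ p ∈ k.2.1, p.1 ∈ k.2.2) →
      ExtendsTo k.1.1 θ (k.2.1 : Set (QU × QU)) k.2.2 := by
    refine eventually_countable_forall.2 fun k => ?_
    by_cases h : (∀ γ, ∀ x ∈ k.2.2, k.1.1 γ x ∈ k.2.2) ∧ ∀ p ∈ k.2.1, p.1 ∈ k.2.2
    · filter_upwards [residual_of_dense_open (isOpen_extendsTo k.1.1 (k.2.1 : Set (QU × QU)) k.2.2)
        (dense_extendsTo hΓ k.1.1 k.2.2.finite_toSet h.1 h.2)] with θ hθ _ _ using hθ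
    · exact Filter.Eventually.of_forall fun θ h' h'' => absurd ⟨h', h''⟩ h
  filter_upwards [h1, exists_fixed_mem_residual hΓ, h2] with θ hθ1 hθ2 hθ3
  refine ⟨hθ1, hθ2, fun π c T hT hinv hcT hc => ?_⟩
  -- There may be uncountably many `π`, but some member of the countable dense set acts on `T`
  -- exactly as `π` does.
  obtain ⟨e, he, heE⟩ := hE'.inter_open_nonempty _ (isOpen_agree π hS hT) ⟨π, fun _ _ _ _ => rfl⟩
  have hagree := agree_of_generators hS' hinv he
  obtain ⟨c', h4, h5, h6⟩ := hθ3 (⟨e, heE⟩, hc.finite.toFinset, hT.toFinset)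
    (by
      intro γ x hx
      simp only [Set.Finite.mem_toFinset] at hx ⊢
      rw [hagree γ x hx]
      exact hinv γ x hx)
    (by simpa using hcT)
    (by
      simp only [Set.Finite.coe_toFinset]
      exact hc.congr (fun γ p hp => hagree γ p.1 (hcT p hp)) fun _ _ _ => rfl)
  simp only [Set.Finite.coe_toFinset] at h4 h6
  refine ⟨c', h4, h5.congr (fun γ p hp => ?_) fun _ _ _ => rfl, h6⟩
  exact (hagree γ p.1 (h6 ▸ ⟨p, hp, rfl⟩)).symm

theorem IsRich.isGeneric [Group.FG Γ] (hΓ : HasPropertyRZ Γ) {π : Γ →* (QU ≃ᵢ QU)}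
    (hπ : IsRich π) : IsGeneric π :=
  Filter.mem_of_superset (isRich_mem_residual hΓ) fun _ hθ => hπ.mem_conjOrbit hθ

theorem exists_isRich_of_mem_residual [Group.FG Γ] (hΓ : HasPropertyRZ Γ)
    {U : Set (Γ →* (QU ≃ᵢ QU))} (hU : U ∈ residual _) : ∃ θ ∈ U, IsRich θ := by
  have := Group.FG.countable' (Γ := Γ)
  have := polishSpace_rep (Γ := Γ)
  have : Nonempty (Γ →* (QU ≃ᵢ QU)) := ⟨1⟩
  exact (dense_of_mem_residual (Filter.inter_mem hU (isRich_mem_residual hΓ))).nonempty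

end Comeagre

/-! ### Restriction to finitely generated subgroups -/

section Restriction

variable {Γ : Type*} [Group Γ]

/-- The image in `Γ` of a product of finitely generated subgroups of `Λ` is again such a product,
and the profinite topology of `Λ` refines the subspace topology. -/
theorem HasPropertyRZ.subgroup (hΓ : HasPropertyRZ Γ) (Λ : Subgroup Γ) : HasPropertyRZ Λ := by
  rw [hasPropertyRZ_iff] at hΓ ⊢
  intro L hL
  have h1 := hΓ (L.map fun H => H.map Λ.subtype) (by
    intro K hK
    obtain ⟨H, hH, rfl⟩ := List.mem_map.1 hK
    exact (hL H hH).map_hom _)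
  have h2 : ((L.map fun H => H.map Λ.subtype).map fun H : Subgroup Γ => (H : Set Γ)).prod =
      Λ.subtype '' (L.map fun H : Subgroup Λ => (H : Set Λ)).prod := by
    clear h1 hL
    induction L with
    | nil => simp [Set.singleton_one]
    | cons H L ih => simp only [List.map_cons, List.prod_cons, Set.image_mul, ih, Subgroup.coe_map]
  rw [h2] at h1
  refine @IsClosed.mk _ (profiniteTopology Λ) _ (isOpen_profinite_iff.2 fun z hz => ?_)
  obtain ⟨N, hN, hN', h⟩ := isOpen_profinite_iff.1 (@IsClosed.isOpen_compl _ (profiniteTopology Γ) _ h1)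
    z (fun h => hz (by
      obtain ⟨w, hw, hwz⟩ := h
      rwa [Subtype.ext hwz] at hw))
  refine ⟨N.subgroupOf Λ, inferInstance, inferInstance, fun n hn hn' => ?_⟩
  exact h n hn ⟨z * n, hn', rfl⟩

/-- Finite index subgroups of a finitely generated subgroup are induced by finite index subgroups
of the group. -/
theorem HasPropertyRZ.exists_inf_le (hΓ : HasPropertyRZ Γ) {Λ : Subgroup Γ} (hΛ : Λ.FG)
    (K : Subgroup Λ) [hK : K.Normal] [K.FiniteIndex] :
    ∃ N : Subgroup Γ, N.Normal ∧ N.FiniteIndex ∧ ∀ l : Λ, (l : Γ) ∈ N → l ∈ K := by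
  have : Group.FG Λ := (Group.fg_iff_subgroup_fg Λ).2 hΛ
  -- A finite index subgroup of a finitely generated group is finitely generated, so (RZ) makes `K`
  -- closed in `Γ`. It then suffices to separate finitely many coset representatives from it.
  have hKfg : K.FG := (Group.fg_iff_subgroup_fg K).1 (Subgroup.fg_of_index_ne_zero K)
  have hP := IsCosetProduct.of_subgroup (hKfg.map_hom Λ.subtype)
  have : ∀ q : Λ ⧸ K, ∃ N : Subgroup Γ, N.Normal ∧ N.FiniteIndex ∧ (q.out ∉ K →
      ∀ n ∈ N, (q.out : Γ) * n ∉ K.map Λ.subtype) := fun q => by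
    by_cases h : q.out ∈ K
    · exact ⟨⊤, inferInstance, inferInstance, fun h' => absurd h h'⟩
    · obtain ⟨N, h1, h2, h3⟩ := hP.exists_separating hΓ (z := (q.out : Γ)) (by
        rintro ⟨k, hk, hkq⟩
        exact h (by rwa [← Subtype.ext hkq]))
      exact ⟨N, h1, h2, fun _ => h3⟩
  choose N h1 h2 h3 using this
  refine ⟨⨅ q, N q, Subgroup.normal_iInf_normal h1, Subgroup.finiteIndex_iInf h2, fun l hl => ?_⟩
  by_contra hlK
  obtain ⟨k, hk⟩ := QuotientGroup.mk_out_eq_mul K l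
  refine h3 l (fun h => hlK ?_) (l : Γ)⁻¹ (inv_mem (Subgroup.mem_iInf.1 hl _))
    ⟨l * k * l⁻¹, hK.conj_mem k k.2 l, by simp [hk]⟩
  rw [hk] at h
  simpa using K.mul_mem h (K.inv_mem k.2)

/-- The `Λ`-action on `T` is induced to a finite `Γ`-action amalgamated with `θ` on `A`; richness of
`θ` over `Γ` maps this back into `θ`, fixing `A` pointwise. -/
theorem IsRich.restrict (hΓ : HasPropertyRZ Γ) {Λ : Subgroup Γ} (hΛ : Λ.FG)
    {θ : Γ →* (QU ≃ᵢ QU)} (hθ : IsRich θ) : IsRich (θ.comp Λ.subtype) where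
  orbit_finite x := (hθ.orbit_finite x).subset (by
    rintro _ ⟨l, rfl⟩
    exact ⟨l, rfl⟩)
  exists_fixed := by
    obtain ⟨z, hz⟩ := hθ.exists_fixed
    exact ⟨z, fun l => hz l⟩
  extends_to := by
    intro π c T hT hinv hcT hc
    obtain ⟨A, hA, hsub, hAinv⟩ := exists_finite_invariant θ (hc.finite.image Prod.snd)
      fun x _ => hθ.orbit_finite x
    obtain ⟨N₁, hN₁, hN₁', h1⟩ := exists_finiteIndex_fixing θ hA hAinv
    obtain ⟨K, hK, hK', h2⟩ := exists_finiteIndex_fixing π hT hinv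
    -- The action on `T` must factor through the image of `Λ` in a finite quotient of `Γ`; this is
    -- where (RZ) is used.
    obtain ⟨N₂, hN₂, hN₂', h3⟩ := hΓ.exists_inf_le hΛ K
    obtain ⟨θ', h4, h5, f, h6, h7, h8⟩ := exists_amalgamating_rep Λ.subtype (N₁ ⊓ N₂) θ π hA hT
      hAinv hinv (fun n hn => h1 n hn.1) (fun l hl => h2 l (h3 l hl.2)) hc.nonempty hcT
      (fun p hp => hsub ⟨p, hp, rfl⟩) hc.isom hc.equivariant
    obtain ⟨T', hT', hsub', hinv'⟩ := exists_finite_invariant θ' (hA.union (hT.image f))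
      fun x _ => finite_orbit θ' (N := N₁ ⊓ N₂) inferInstance fun n hn => by rw [h4 n hn]; rfl
    have hdiag : IsPartialIso θ' θ ((fun a => (a, a)) '' A) := by
      refine ⟨hA.image _, ?_, ?_, ?_⟩
      · obtain ⟨p, hp⟩ := hc.nonempty
        exact ⟨_, p.2, hsub ⟨p, hp, rfl⟩, rfl⟩
      · rintro _ ⟨a, _, rfl⟩ _ ⟨b, _, rfl⟩
        rfl
      · rintro γ _ ⟨a, ha, rfl⟩
        exact ⟨_, hAinv γ a ha, by simp [h5 γ a ha]⟩
    obtain ⟨c', h9, h10, h11⟩ := hθ.extends_to θ' _ T' hT' hinv' (by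
      rintro _ ⟨a, ha, rfl⟩
      exact hsub' (Or.inl ha)) hdiag
    -- The composite of `f : T → T'` with `c'`. It extends `c` because `f` sends `p.1` to `p.2` and
    -- `c'` is the identity on `A`.
    refine ⟨{p | p.1 ∈ T ∧ (f p.1, p.2) ∈ c'}, fun p hp => ⟨hcT p hp, ?_⟩, ⟨?_, ?_, ?_, ?_⟩, ?_⟩
    · rw [h7 p hp]
      exact h9 ⟨p.2, hsub ⟨p, hp, rfl⟩, rfl⟩
    · exact (hT.prod (h10.finite.image Prod.snd)).subset fun p hp => ⟨hp.1, _, hp.2, rfl⟩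
    · obtain ⟨p, hp⟩ := hc.nonempty
      refine ⟨p, hcT p hp, ?_⟩
      rw [h7 p hp]
      exact h9 ⟨p.2, hsub ⟨p, hp, rfl⟩, rfl⟩
    · rintro p ⟨hp, hp'⟩ q ⟨hq, hq'⟩
      rw [← h6 _ hp _ hq]
      exact h10.isom _ hp' _ hq'
    · rintro l p ⟨hp, hp'⟩
      refine ⟨hinv l _ hp, ?_⟩
      rw [h8 l _ hp]
      exact h10.equivariant l _ hp'
    · ext t
      constructor
      · rintro ⟨p, hp, rfl⟩
        exact hp.1
      · intro ht
        have : f t ∈ Prod.fst '' c' := h11 ▸ hsub' (Or.inr ⟨t, ht, rfl⟩)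
        obtain ⟨⟨_, y⟩, hp, rfl⟩ := this
        exact ⟨(t, y), ⟨ht, hp⟩, rfl⟩

end Restriction

section Conj

variable {Γ G : Type*} [Group Γ] [Group G]

theorem conjOrbit_symm {π θ : Γ →* G} (h : θ ∈ conjOrbit π) : π ∈ conjOrbit θ := by
  obtain ⟨a, ha⟩ := h
  exact ⟨a⁻¹, fun γ => by rw [← ha]; group⟩

theorem conjOrbit_trans {π θ ρ : Γ →* G} (h : θ ∈ conjOrbit π) (h' : ρ ∈ conjOrbit θ) :
    ρ ∈ conjOrbit π := by
  obtain ⟨a, ha⟩ := h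
  obtain ⟨b, hb⟩ := h'
  exact ⟨b * a, fun γ => by rw [← hb, ← ha]; group⟩

theorem IsGeneric.of_mem_conjOrbit [TopologicalSpace G] {π θ : Γ →* G} (hπ : IsGeneric π)
    (h : θ ∈ conjOrbit π) : IsGeneric θ :=
  Filter.mem_of_superset hπ fun _ hρ => conjOrbit_trans (conjOrbit_symm h) hρ

theorem conjOrbit_comp {Λ : Type*} [Group Λ] {π θ : Γ →* G} (h : θ ∈ conjOrbit π) (ι : Λ →* Γ) :
    θ.comp ι ∈ conjOrbit (π.comp ι) := by
  obtain ⟨a, ha⟩ := h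
  exact ⟨a, fun l => ha (ι l)⟩

end Conj

theorem mainTheorem3 {Γ : Type*} [Group Γ] [Group.FG Γ] (hΓ : HasPropertyRZ Γ)
    (Λ : Subgroup Γ) (hΛ : Λ.FG) :
    (∀ π : Γ →* (QU ≃ᵢ QU), IsGeneric π → IsGeneric (π.comp Λ.subtype)) ∧
      (∀ σ : Λ →* (QU ≃ᵢ QU), IsGeneric σ →
        ∃ π : Γ →* (QU ≃ᵢ QU), IsGeneric π ∧ π.comp Λ.subtype = σ) := by
  have : Group.FG Λ := (Group.fg_iff_subgroup_fg Λ).2 hΛ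
  have hΛ' := hΓ.subgroup Λ
  constructor
  · intro π hπ
    -- By Baire category the comeagre orbit of `π` contains a rich representation.
    obtain ⟨θ, hθ, hθ'⟩ := exists_isRich_of_mem_residual hΓ hπ
    exact ((hθ'.restrict hΓ hΛ).isGeneric hΛ').of_mem_conjOrbit
      (conjOrbit_comp (conjOrbit_symm hθ) _)
  · intro σ hσ
    obtain ⟨τ, hτ, hτ'⟩ := exists_isRich_of_mem_residual hΛ' hσ
    obtain ⟨θ, -, hθ⟩ := exists_isRich_of_mem_residual hΓ (Filter.univ_mem)
    -- Any rich `θ` restricts to a conjugate of `σ`; conjugating `θ` by the same element `a` makes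
    -- the restriction equal to `σ`.
    obtain ⟨a, ha⟩ := conjOrbit_trans ((hθ.restrict hΓ hΛ).mem_conjOrbit hτ') (conjOrbit_symm hτ)
    refine ⟨(MulAut.conj a).toMonoidHom.comp θ, (hθ.isGeneric hΓ).of_mem_conjOrbit
      ⟨a, fun γ => rfl⟩, MonoidHom.ext fun l => ha l⟩
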